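/- Let $(R,\mathfrak m)$ be a Cohen–Macaulay local ring and let $I=(a_1,\dots,a_g)$, $g\ge 1$, be an ideal generated by an $R$-regular sequence $a_1,\dots,a_g$ (so $I$ has height $g$). Let $\mathcal F=\{I_n\}$ be an $I$-admissible filtration, i.e. a descending chain of ideals $R=I_0\supseteq I_1\supseteq I_2\supseteq\cdots$ with $I_iI_j\subseteq I_{i+j}$ for all $i,j\ge 0$, with $I^n\subseteq I_n$ for all $n$, and such that for some $k\in\mathbb N$ one has $I_n\subseteq I^{n-k}$ for all $n$; put $I_n=I^n=R$ for $n\le 0$. Let $\mathcal R'(I)=\bigoplus_{n\in\mathbb Z}I^nt^n$ and $\mathcal R'(\mathcal F)=\bigoplus_{n\in\mathbb Z}I_nt^n$ be the extended Rees algebras (inside $R[t,t^{-1}]$), let $J=(t^{-1},It)\mathcal R'(I)$, and let $G(\mathcal F)=\bigoplus_{n\ge 0}I_n/I_{n+1}$ be the associated graded ring, whose depth is taken with respect to its maximal homogeneous ideal $\mathfrak m/I_1\oplus\bigoplus_{n>0}I_n/I_{n+1}$. Let $r\ge 1$ be an integer. Suppose that the graded components of local cohomology satisfy $$H^i_J(\mathcal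 R'(\mathcal F))_j=0\quad\text{for all integers } i,j \text{ with } i+j=r+1 \text{ and } 1\le i\le g,$$ and that $\operatorname{depth} G(\mathcal F)\ge g-1$. Then $$I^n\cap I_{n+r}=I^nI_r\qquad\text{for all } n\ge 0.$$ -/

import Mathlib

open scoped LaurentPolynomial

/-! ### Depth and Cohen–Macaulay local rings -/

/-- The depth (grade) of a ring `A` with respect to an ideal `𝔞`: the supremum of the lengths of
the `A`-regular sequences that consist of elements of `𝔞`. -/
noncomputable def idealDepth {A : Type*} [CommRing A] (𝔞 : Ideal A) : ℕ∞ :=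
  ⨆ rs ∈ {rs : List A | RingTheory.Sequence.IsRegular A rs ∧ ∀ y ∈ rs, y ∈ 𝔞}, (rs.length : ℕ∞)

/-- A Cohen–Macaulay local ring: a Noetherian local ring whose depth (with respect to its maximal
ideal) equals its Krull dimension. -/
structure IsCohenMacaulayLocal (R : Type*) [CommRing R] [IsLocalRing R] : Prop where
  isNoetherianRing : IsNoetherianRing R
  depth_eq_dim : (idealDepth (IsLocalRing.maximalIdeal R) : WithBot ℕ∞) = ringKrullDim R

/-! ### Filtrations of ideals -/

/-- A descending chain `R = I₀ ⊇ I₁ ⊇ I₂ ⊇ ⋯` of ideals with `Iᵢ Iⱼ ⊆ Iᵢ₊ⱼ`.  The convention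
`Iₙ = R` for `n ≤ 0` is implemented by `n ↦ I (n.toNat)` where integer indices occur. -/
structure IdealFiltration (R : Type*) [CommRing R] where
  ideal : ℕ → Ideal R
  zero_eq : ideal 0 = ⊤
  antitone : Antitone ideal
  mul_le : ∀ i j, ideal i * ideal j ≤ ideal (i + j)

namespace IdealFiltration

variable {R : Type*} [CommRing R]

/-- The `I`-adic filtration `{Iⁿ}`. -/
def adic (I : Ideal R) : IdealFiltration R where
  ideal n := I ^ n
  zero_eq := by simp
  antitone _ _ h := Ideal.pow_le_pow_right h
  mul_le i j := (pow_add I i j).ge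

/-- `F` is `I`-admissible: `Iⁿ ⊆ Iₙ` for all `n`, and for some `k`, `Iₙ ⊆ Iⁿ⁻ᵏ` for all `n`
(where `Iᵐ = R` for `m ≤ 0`, as the truncated subtraction gives). -/
structure IsAdmissible (I : Ideal R) (F : IdealFiltration R) : Prop where
  pow_le : ∀ n, I ^ n ≤ F.ideal n
  le_pow : ∃ k : ℕ, ∀ n, F.ideal n ≤ I ^ (n - k)

/-- The extended Rees algebra `⨁_{n ∈ ℤ} Iₙ tⁿ ⊆ R[t, t⁻¹]`. -/
noncomputable def extRees (F : IdealFiltration R) : Subalgebra R R[T;T⁻¹] where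
  carrier := {f | ∀ n : ℤ, f.coeff n ∈ F.ideal n.toNat}
  mul_mem' {f g} hf hg n := by
    classical
    rw [AddMonoidAlgebra.coeff_mul]
    refine Ideal.sum_mem _ fun i _ => Ideal.sum_mem _ fun j _ => ?_
    dsimp only
    split_ifs with h
    · exact F.antitone (by omega) (F.mul_le _ _ (Ideal.mul_mem_mul (hf i) (hg j)))
    · exact zero_mem _
  add_mem' {f g} hf hg n := by
    rw [AddMonoidAlgebra.coeff_add]
    exact add_mem (hf n) (hg n)
  algebraMap_mem' r n := by
    rw [← LaurentPolynomial.C_eq_algebraMap, LaurentPolynomial.C_apply]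
    split_ifs with h
    · subst h
      simp [F.zero_eq]
    · exact zero_mem _

/-- The Rees algebra `⨁_{n ≥ 0} Iₙ tⁿ ⊆ R[t]`. -/
def rees (F : IdealFiltration R) : Subalgebra R (Polynomial R) where
  carrier := {f | ∀ n, f.coeff n ∈ F.ideal n}
  mul_mem' {f g} hf hg n := by
    rw [Polynomial.coeff_mul]
    refine Ideal.sum_mem _ fun ij hij => ?_
    rw [← Finset.HasAntidiagonal.mem_antidiagonal.mp hij]
    exact F.mul_le _ _ (Ideal.mul_mem_mul (hf _) (hg _))
  add_mem' {f g} hf hg n := by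
    rw [Polynomial.coeff_add]
    exact add_mem (hf n) (hg n)
  algebraMap_mem' r n := by
    rw [Polynomial.algebraMap_apply, Polynomial.coeff_C]
    split_ifs with h
    · subst h
      simp [F.zero_eq]
    · exact zero_mem _

/-- The ideal `⨁_{n ≥ 0} Iₙ₊₁ tⁿ` of the Rees algebra. -/
def reesShift (F : IdealFiltration R) : Ideal F.rees where
  carrier := {f | ∀ n, (f : Polynomial R).coeff n ∈ F.ideal (n + 1)}
  zero_mem' n := by simp
  add_mem' {f g} hf hg n := by
    simpa using add_mem (hf n) (hg n)
  smul_mem' f g hg n := by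
    rw [smul_eq_mul, MulMemClass.coe_mul, Polynomial.coeff_mul]
    refine Ideal.sum_mem _ fun ij hij => ?_
    rw [← Finset.HasAntidiagonal.mem_antidiagonal.mp hij, add_assoc]
    exact F.mul_le _ _ (Ideal.mul_mem_mul (f.2 _) (hg _))

/-- The associated graded ring `G(F) = ⨁_{n ≥ 0} Iₙ / Iₙ₊₁`, as the quotient of the Rees algebra
`⨁ Iₙ tⁿ` by `⨁ Iₙ₊₁ tⁿ`. -/
abbrev assocGraded (F : IdealFiltration R) : Type _ := F.rees ⧸ F.reesShift

/-- The homogeneous ideal `𝔪/I₁ ⊕ ⨁_{n > 0} Iₙ/Iₙ₊₁` of `G(F)`, which is its unique maximal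
homogeneous ideal when `I₁` is a proper ideal of the local ring `(R, 𝔪)`. -/
noncomputable def gradedMaximalIdeal [IsLocalRing R] (F : IdealFiltration R) : Ideal F.assocGraded :=
  (((IsLocalRing.maximalIdeal R).comap
    (Polynomial.constantCoeff.comp F.rees.val.toRingHom))).map (Ideal.Quotient.mk F.reesShift)

/-- `depth G(F)`. -/
noncomputable def gradedDepth [IsLocalRing R] (F : IdealFiltration R) : ℕ∞ :=
  idealDepth (A := F.assocGraded) F.gradedMaximalIdeal

/-- The extended Rees algebra `⨁_{n ∈ ℤ} Iₙ tⁿ` of an `I`-filtration as a module over the extended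
Rees algebra `⨁_{n ∈ ℤ} Iⁿ tⁿ` of `I`. -/
noncomputable def extReesModule {I : Ideal R} {F : IdealFiltration R} (h : F.IsAdmissible I) :
    Submodule (adic I).extRees R[T;T⁻¹] where
  carrier := F.extRees
  zero_mem' := zero_mem F.extRees
  add_mem' hf hg := add_mem hf hg
  smul_mem' a f hf := by
    have ha : (a : R[T;T⁻¹]) ∈ F.extRees := fun n => h.pow_le _ (a.2 n)
    exact mul_mem ha hf

/-- The homogeneous component `Iⱼ tʲ` of the extended Rees algebra. -/
def extReesDegree {I : Ideal R} {F : IdealFiltration R} (h : F.IsAdmissible I) (j : ℤ) :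
    AddSubgroup (extReesModule h) where
  carrier := {f | ∀ n, n ≠ j → (f : R[T;T⁻¹]).coeff n = 0}
  zero_mem' n _ := by simp
  add_mem' {f g} hf hg n hn := by simp [hf n hn, hg n hn]
  neg_mem' {f} hf n hn := by simp [hf n hn]

end IdealFiltration

/-! ### Graded local cohomology through the Čech complex -/

namespace Cech

variable {A : Type*} [CommRing A] {g : ℕ} (x : Fin g → A) (M : Type*) [AddCommGroup M] [Module A M]

/-- The localization `M_{x_S}` of `M` at the element `x_S = ∏_{k ∈ S} x_k`. -/
def Loc (S : Finset (Fin g)) : Type _ :=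
  LocalizedModule (Submonoid.powers (∏ k ∈ S, x k)) M

noncomputable instance (S : Finset (Fin g)) : AddCommGroup (Loc x M S) :=
  inferInstanceAs (AddCommGroup (LocalizedModule (Submonoid.powers (∏ k ∈ S, x k)) M))

noncomputable instance (S : Finset (Fin g)) : Module A (Loc x M S) :=
  inferInstanceAs (Module A (LocalizedModule (Submonoid.powers (∏ k ∈ S, x k)) M))

/-- The canonical map `M → M_{x_S}`. -/
noncomputable def toLoc (S : Finset (Fin g)) : M →ₗ[A] Loc x M S :=
  LocalizedModule.mkLinearMap (Submonoid.powers (∏ k ∈ S, x k)) M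

instance (S : Finset (Fin g)) :
    IsLocalizedModule (Submonoid.powers (∏ k ∈ S, x k)) (toLoc x M S) :=
  inferInstanceAs (IsLocalizedModule (Submonoid.powers (∏ k ∈ S, x k))
    (LocalizedModule.mkLinearMap (Submonoid.powers (∏ k ∈ S, x k)) M))

theorem isUnit_of_subset {S S' : Finset (Fin g)} (h : S ⊆ S')
    (y : Submonoid.powers (∏ k ∈ S, x k)) :
    IsUnit (algebraMap A (Module.End A (Loc x M S')) y) := by
  obtain ⟨_, p, rfl⟩ := y
  have h1 := IsLocalizedModule.map_units (toLoc x M S')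
    ⟨∏ k ∈ S', x k, Submonoid.mem_powers _⟩
  have h3 : ∏ k ∈ S', x k = (∏ k ∈ S' \ S, x k) * ∏ k ∈ S, x k := (Finset.prod_sdiff h).symm
  simp only [h3, map_mul] at h1
  have h2 := (Commute.isUnit_mul_iff (Algebra.commutes _ _)).mp h1
  simpa using h2.2.pow p

/-- The localization map `M_{x_S} → M_{x_S'}` for `S ⊆ S'`. -/
noncomputable def res {S S' : Finset (Fin g)} (h : S ⊆ S') : Loc x M S →ₗ[A] Loc x M S' :=
  IsLocalizedModule.lift (Submonoid.powers (∏ k ∈ S, x k)) (toLoc x M S) (toLoc x M S')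
    (isUnit_of_subset x M h)

/-- The `i`-th term `∏_{k₁ < ⋯ < kᵢ} M_{x_{k₁} ⋯ x_{kᵢ}}` of the Čech complex. -/
abbrev Cochain (i : ℕ) : Type _ := ∀ S : {S : Finset (Fin g) // S.card = i}, Loc x M S

/-- The `i`-element set `S ∖ {k}`, for a set `S` with `i + 1` elements and `k ∈ S`. -/
def face {i : ℕ} (S : {S : Finset (Fin g) // S.card = i + 1}) (k : S.1) :
    {S : Finset (Fin g) // S.card = i} :=
  ⟨S.1.erase k.1, by rw [Finset.card_erase_of_mem k.2, S.2, Nat.add_sub_cancel]⟩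

theorem face_subset {i : ℕ} (S : {S : Finset (Fin g) // S.card = i + 1}) (k : S.1) :
    (face S k).1 ⊆ S.1 := S.1.erase_subset k.1

/-- The differential of the Čech complex: on the component of `S = {k₀ < ⋯ < kᵢ}` it is the
alternating sum of the localization maps from the components of `S ∖ {k_l}`, with sign `(-1)ˡ`. -/
noncomputable def d (i : ℕ) : Cochain x M i →ₗ[A] Cochain x M (i + 1) where
  toFun c S := ∑ k : S.1, (-1 : A) ^ (S.1.filter (· < k.1)).card •
    res x M (face_subset S k) (c (face S k))
  map_add' b c := by
    funext S
    simp only [Pi.add_apply, map_add, smul_add, Finset.sum_add_distrib]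
  map_smul' r c := by
    funext S
    simp only [Pi.smul_apply, map_smul, Finset.smul_sum, smul_comm r, RingHom.id_apply]

theorem res_res {S S' S'' : Finset (Fin g)} (h : S ⊆ S') (h' : S' ⊆ S'') (y : Loc x M S) :
    res x M h' (res x M h y) = res x M (h.trans h') y := by
  have : (res x M h').comp (res x M h) = res x M (h.trans h') := by
    symm
    apply IsLocalizedModule.lift_unique
    ext m
    simp [res, IsLocalizedModule.lift_apply]
  exact LinearMap.congr_fun this y

theorem res_congr {i : ℕ} (c : Cochain x M i) {S S' : {S : Finset (Fin g) // S.card = i}}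
    (hS : S = S') {U : Finset (Fin g)} (h : S.1 ⊆ U) (h' : S'.1 ⊆ U) :
    res x M h (c S) = res x M h' (c S') := by
  subst hS; rfl

/-- The Čech complex is a complex. -/
theorem d_d (i : ℕ) (c : Cochain x M i) : d x M (i + 1) (d x M i c) = 0 := by
  funext S
  have key : ∀ k l : S.1, l.1 < k.1 →
      (-1 : A) ^ (S.1.filter (· < k.1)).card * (-1 : A) ^ ((S.1.erase k.1).filter (· < l.1)).card
        = - ((-1 : A) ^ (S.1.filter (· < l.1)).card *
            (-1 : A) ^ ((S.1.erase l.1).filter (· < k.1)).card) := by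
    intro k l hlk
    have h1 : (S.1.erase k.1).filter (· < l.1) = S.1.filter (· < l.1) := by
      ext y; simp only [Finset.mem_filter, Finset.mem_erase]
      constructor
      · rintro ⟨⟨_, h⟩, h'⟩; exact ⟨h, h'⟩
      · rintro ⟨h, h'⟩; exact ⟨⟨(h'.trans hlk).ne, h⟩, h'⟩
    have h2 : (S.1.filter (· < k.1)).card = ((S.1.erase l.1).filter (· < k.1)).card + 1 := by
      rw [Finset.filter_erase, Finset.card_erase_add_one]
      exact Finset.mem_filter.mpr ⟨l.2, hlk⟩
    rw [h1, h2, pow_succ]; ring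
  have e1 : d x M (i + 1) (d x M i c) S = ∑ p : (k : S.1) × (face S k).1,
      ((-1 : A) ^ (S.1.filter (· < p.1.1)).card *
        (-1 : A) ^ ((S.1.erase p.1.1).filter (· < p.2.1)).card) •
      res x M ((face_subset (face S p.1) p.2).trans (face_subset S p.1))
        (c (face (face S p.1) p.2)) := by
    rw [Fintype.sum_sigma]
    simp only [d, LinearMap.coe_mk, AddHom.coe_mk, map_sum, map_smul, Finset.smul_sum, res_res,
      smul_smul]
    rfl
  rw [e1]
  have hne : ∀ p : (k : S.1) × (face S k).1, p.2.1 ≠ p.1.1 := fun p =>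
    (Finset.mem_erase.mp p.2.2).1
  refine Finset.sum_involution
    (fun p _ => ⟨⟨p.2.1, face_subset S p.1 p.2.2⟩,
      ⟨p.1.1, Finset.mem_erase.mpr ⟨(hne p).symm, p.1.2⟩⟩⟩) ?_ ?_ ?_ ?_
  · rintro ⟨k, l⟩ -
    have hkl := hne ⟨k, l⟩
    have hl : l.1 ∈ S.1 := face_subset S k l.2
    have hface : face (face S k) l =
        face (face S ⟨l.1, hl⟩) ⟨k.1, Finset.mem_erase.mpr ⟨hkl.symm, k.2⟩⟩ :=
      Subtype.ext (Finset.erase_right_comm ..)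
    dsimp only
    rw [res_congr x M c hface _ ((face_subset _ _).trans (face_subset _ _)), ← add_smul]
    rcases lt_or_gt_of_ne hkl with h | h
    · rw [key k ⟨l.1, hl⟩ h, neg_add_cancel, zero_smul]
    · rw [key ⟨l.1, hl⟩ k h, add_neg_cancel, zero_smul]
  · rintro p - - h
    exact hne p (congrArg (fun q => q.1.1) h)
  · intros; exact Finset.mem_univ _
  · intros; rfl

variable {M} (ℳ : ℤ → AddSubgroup M) (e : Fin g → ℤ)

/-- The degree `j` component of `M_{x_S}`, where `M` is graded by `ℳ` and `x k` is homogeneous of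
degree `e k`: it consists of the fractions `y = m / x_S^p` with `m` homogeneous of degree
`j + p · deg x_S`. -/
noncomputable def locDegree (j : ℤ) (S : Finset (Fin g)) : AddSubgroup (Loc x M S) :=
  AddSubgroup.closure {y | ∃ p : ℕ, ∃ m ∈ ℳ (j + p * ∑ k ∈ S, e k),
    (∏ k ∈ S, x k) ^ p • y = toLoc x M S m}

/-- The degree `j` component of the `i`-th term of the Čech complex. -/
noncomputable def cochainDegree (i : ℕ) (j : ℤ) : AddSubgroup (Cochain x M i) where
  carrier := {c | ∀ S, c S ∈ locDegree x ℳ e j S.1}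
  zero_mem' _ := zero_mem _
  add_mem' hb hc S := add_mem (hb S) (hc S)
  neg_mem' hc S := neg_mem (hc S)

/-- If `x k` is homogeneous of degree `e k`, then the differential preserves degrees. -/
theorem d_mem_cochainDegree (hx : ∀ k j, ∀ m ∈ ℳ j, x k • m ∈ ℳ (j + e k)) (i : ℕ) (j : ℤ)
    (c : Cochain x M i) (hc : c ∈ cochainDegree x ℳ e i j) :
    d x M i c ∈ cochainDegree x ℳ e (i + 1) j := by
  have hprod : ∀ (U : Finset (Fin g)) (j : ℤ), ∀ m ∈ ℳ j,
      (∏ k ∈ U, x k) • m ∈ ℳ (j + ∑ k ∈ U, e k) := by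
    intro U
    induction U using Finset.induction_on with
    | empty => intro j m hm; simpa using hm
    | insert k U hk ih =>
      intro j m hm
      rw [Finset.prod_insert hk, Finset.sum_insert hk, mul_smul, add_comm (e k), ← add_assoc]
      exact hx _ _ _ (ih _ _ hm)
  have hpow : ∀ (U : Finset (Fin g)) (p : ℕ) (j : ℤ), ∀ m ∈ ℳ j,
      (∏ k ∈ U, x k) ^ p • m ∈ ℳ (j + p * ∑ k ∈ U, e k) := by
    intro U p
    induction p with
    | zero => intro j m hm; simpa using hm
    | succ p ih =>
      intro j m hm
      rw [pow_succ', mul_smul]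
      convert hprod U _ _ (ih _ _ hm) using 2
      push_cast; ring
  have hres : ∀ {S S' : Finset (Fin g)} (h : S ⊆ S') (y : Loc x M S),
      y ∈ locDegree x ℳ e j S → res x M h y ∈ locDegree x ℳ e j S' := by
    intro S S' h y hy
    refine AddSubgroup.closure_induction (p := fun y _ => res x M h y ∈ locDegree x ℳ e j S')
      ?_ ?_ ?_ ?_ hy
    · rintro y ⟨p, m, hm, hy⟩
      refine AddSubgroup.subset_closure ⟨p, (∏ k ∈ S' \ S, x k) ^ p • m, ?_, ?_⟩
      · have := hpow (S' \ S) p _ m hm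
        rwa [add_assoc, ← mul_add, add_comm (∑ k ∈ S, e k), Finset.sum_sdiff h] at this
      · rw [← Finset.prod_sdiff h, mul_pow, mul_smul, ← map_smul, hy, map_smul]
        simp [res, IsLocalizedModule.lift_apply]
    · simp
    · intro y z _ _ hy hz
      rw [map_add]; exact add_mem hy hz
    · intro y _ hy
      rw [map_neg]; exact neg_mem hy
  intro S
  refine sum_mem fun k _ => ?_
  have h := hres (face_subset S k) _ (hc (face S k))
  rcases neg_one_pow_eq_or A (S.1.filter (· < k.1)).card with h' | h'
  · rw [h', one_smul]; exact h
  · rw [h', neg_one_smul]; exact neg_mem h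

/-- The `i`-cocycles of degree `j`. -/
noncomputable def cocycles (i : ℕ) (j : ℤ) : AddSubgroup (Cochain x M i) :=
  cochainDegree x ℳ e i j ⊓ (d x M i).toAddMonoidHom.ker

/-- The `i`-coboundaries of degree `j`: the differentials of `(i - 1)`-cochains of degree `j`. -/
noncomputable def coboundaries (i : ℕ) (j : ℤ) : AddSubgroup (Cochain x M i) :=
  match i with
  | 0 => ⊥
  | i + 1 => (cochainDegree x ℳ e i j).map (d x M i).toAddMonoidHom

/-- The degree `j` component `Hⁱ_J(M)_j` of the `i`-th local cohomology of the graded module `M`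
with support in the ideal `J` generated by the homogeneous elements `x k` of degree `e k`: the
cohomology at the `i`-th place of the degree `j` strand of the Čech complex. -/
abbrev gradedCohomology (i : ℕ) (j : ℤ) : Type _ :=
  cocycles x ℳ e i j ⧸ (coboundaries x ℳ e i j).addSubgroupOf (cocycles x ℳ e i j)

end Cech

namespace IdealFiltration

variable {R : Type*} [CommRing R] {g : ℕ} (a : Fin g → R)

/-- The element `t⁻¹` of the extended Rees algebra of an ideal. -/
noncomputable def tInv (I : Ideal R) : (adic I).extRees :=
  ⟨LaurentPolynomial.T (-1), fun n => by
    rw [LaurentPolynomial.T_apply]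
    split_ifs with h
    · subst h
      simp [adic]
    · exact zero_mem _⟩

/-- The element `c t` of the extended Rees algebra of an ideal `I`, for `c ∈ I`. -/
noncomputable def mulT {I : Ideal R} (c : I) : (adic I).extRees :=
  ⟨LaurentPolynomial.C (c : R) * LaurentPolynomial.T 1, fun n => by
    rw [← LaurentPolynomial.single_eq_C_mul_T, AddMonoidAlgebra.coeff_single, Finsupp.single_apply]
    split_ifs with h
    · subst h
      simp [adic]
    · exact zero_mem _⟩

/-- The ideal `J = (t⁻¹, I t)` of the extended Rees algebra of `I`. -/
noncomputable def idealJ (I : Ideal R) : Ideal (adic I).extRees :=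
  Ideal.span (insert (tInv I) (Set.range (mulT (I := I))))

/-- The generators `t⁻¹, a₁ t, …, a_g t` of `J`, where `I = (a₁, …, a_g)`. -/
noncomputable def generatorsJ : Fin (g + 1) → (adic (Ideal.span (Set.range a))).extRees :=
  Fin.cons (tInv _) fun k => mulT ⟨a k, Ideal.subset_span ⟨k, rfl⟩⟩

theorem span_generatorsJ :
    Ideal.span (Set.range (generatorsJ a)) = idealJ (Ideal.span (Set.range a)) := by
  apply le_antisymm
  · rw [Ideal.span_le]
    rintro _ ⟨k, rfl⟩
    refine Fin.cases ?_ (fun k => ?_) k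
    · exact Ideal.subset_span (Set.mem_insert _ _)
    · exact Ideal.subset_span (Set.mem_insert_of_mem _ ⟨_, rfl⟩)
  · rw [idealJ, Ideal.span_le]
    rintro _ (rfl | ⟨⟨c, hc⟩, rfl⟩)
    · exact Ideal.subset_span ⟨0, rfl⟩
    · obtain ⟨b, rfl⟩ := (Ideal.mem_span_range_iff_exists_fun).mp hc
      have : mulT ⟨∑ k, b k * a k, hc⟩ =
          ∑ k, algebraMap R (adic (Ideal.span (Set.range a))).extRees (b k) *
            generatorsJ a k.succ := by
        apply Subtype.ext
        rw [AddSubmonoidClass.coe_finsetSum]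
        change LaurentPolynomial.C (∑ k, b k * a k) * LaurentPolynomial.T 1 = _
        rw [map_sum, Finset.sum_mul]
        refine Finset.sum_congr rfl fun k _ => ?_
        change _ = LaurentPolynomial.C (b k) * (LaurentPolynomial.C (a k) * LaurentPolynomial.T 1)
        rw [map_mul, mul_assoc]
      rw [SetLike.mem_coe, this]
      exact Ideal.sum_mem _ fun k _ => Ideal.mul_mem_left _ _ (Ideal.subset_span ⟨k.succ, rfl⟩)

/-- The degrees `-1, 1, …, 1` of the generators `t⁻¹, a₁ t, …, a_g t`. -/
def degreesJ (g : ℕ) : Fin (g + 1) → ℤ := Fin.cons (-1) fun _ => 1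

theorem generatorsJ_smul_mem {F : IdealFiltration R}
    (h : F.IsAdmissible (Ideal.span (Set.range a))) (k : Fin (g + 1)) (j : ℤ)
    (f : extReesModule h) (hf : f ∈ extReesDegree h j) :
    generatorsJ a k • f ∈ extReesDegree h (j + degreesJ g k) := by
  intro n hn
  have hmul : ∀ (c : R) (l : ℤ), j + l ≠ n →
      (AddMonoidAlgebra.single l c * (f : R[T;T⁻¹])).coeff n = 0 := by
    intro c l hl
    have := AddMonoidAlgebra.coeff_single_mul_eq_mul_coeff (x := (f : R[T;T⁻¹])) (m := l) (m₁ := n)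
      (r := c) (n - l) (fun m' _ => by omega)
    rw [this, hf _ (by omega), mul_zero]
  revert hn
  refine Fin.cases (fun hn => ?_) (fun k hn => ?_) k
  · exact hmul 1 (-1) (Ne.symm hn)
  · have := hmul (a k) 1 (Ne.symm hn)
    rwa [LaurentPolynomial.single_eq_C_mul_T] at this

/-- The graded component `Hⁱ_J(R'(F))_j` of the local cohomology of the extended Rees algebra of
`F`, as a graded module over the extended Rees algebra of `I = (a₁, …, a_g)`, with support in
`J = (t⁻¹, I t)`. -/
abbrev localCohomologyExtRees {F : IdealFiltration R}
    (h : F.IsAdmissible (Ideal.span (Set.range a))) (i : ℕ) (j : ℤ) : Type _ :=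
  Cech.gradedCohomology (generatorsJ a) (extReesDegree h) (degreesJ g) i j

end IdealFiltration

/-! ### Koszul operators on exterior powers with polynomial coefficients -/

/-! Write `M` for the extended Rees algebra of the filtration, and `x₀ = t⁻¹`, `x_k = a_k t`. For `n
≥ 1` and `c` in `Iⁿ ∩ I_{n+r}`, the element `m = c t^{n+r}` of `M` should be a value `∑ x^α u_α` of
a form of degree `n` in variables `Y₁, …, Y_g` with coefficients in `M_r`; comparing coefficients of
`t^{n+r}` then gives `c ∈ Iⁿ I_r`. Locally this is easy. Where some `x_k` with `k ≥ 1` is inverted,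
`m = x_k^n (m / x_k^n)`. Where `t⁻¹` is inverted, write `c = ∑ a^α v_α` and divide `v_α` by
`t^{-r}`. So there is a form `z` with coefficients in the Čech 1-cochains of degree `r` whose value
is the image of `m`.

Gluing uses the complex `L_q = ker (dY : ⋀^q ⊗ B[Y]_n → ⋀^{q-1} ⊗ B[Y]_{n+1})` with differential
`dX`, augmented by evaluation `L₀ → B` at `Y = X`. It has two virtues. It is exact as soon as one
`X_k` is invertible on `B` (`Koszul.exists_dX_eq`), in particular on Čech cochains of degree at
least 2, since a set of two indices contains some `k ≥ 1`. And it is linear and short: `L_q`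
vanishes for `q ≥ g`, and each step lowers the coefficient degree by exactly one.

Hence in the double complex of Čech cochains with values in `L_q`, the chase from `z` meets only the
groups `H^{q+1}_J(M)_{r-q}` with `0 ≤ q < g`, which lie on the diagonal `i + j = r + 1` and vanish.
The chase (`Cech.exists_eq_d_add_dX`) writes `z = d b + dX w`. Evaluation kills `dX w` because `dY w
= 0`, so `m` is locally the value of `b`, whose coefficients are global elements of `M_r`. Since
`t⁻¹` is a unit of `R[t, t⁻¹]`, equality after inverting `t⁻¹` is equality in `M`. -/

namespace Koszul

variable {A : Type*} [CommRing A] {g : ℕ}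

/-- The sign of `e_i ∧ e_T` with respect to `e_{T ∪ {i}}`. -/
def sgn (A : Type*) [CommRing A] (i : Fin g) (T : Finset (Fin g)) : A :=
  (-1) ^ (T.filter (· < i)).card

theorem sgn_mul_self (i : Fin g) (T : Finset (Fin g)) : sgn A i T * sgn A i T = 1 := by
  rw [sgn, ← mul_pow]; simp

theorem sgn_insert_of_lt {i j : Fin g} {T : Finset (Fin g)} (hj : j ∉ T) (h : j < i) :
    sgn A i (insert j T) = - sgn A i T := by
  rw [sgn, Finset.filter_insert, if_pos h, Finset.card_insert_of_notMem (by simp [hj]), pow_succ,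
    sgn]
  ring

theorem sgn_insert_of_gt {i j : Fin g} {T : Finset (Fin g)} (h : i < j) :
    sgn A i (insert j T) = sgn A i T := by
  rw [sgn, Finset.filter_insert, if_neg h.not_gt, sgn]

/-- This is `e_i ∧ e_j = - e_j ∧ e_i`, the source of every cancellation of signs below. -/
theorem sgn_mul_sgn_insert {i j : Fin g} {T : Finset (Fin g)} (hi : i ∉ T) (hj : j ∉ T)
    (hij : i ≠ j) :
    sgn A i T * sgn A j (insert i T) = - (sgn A j T * sgn A i (insert j T)) := by
  rcases lt_or_gt_of_ne hij with h | h
  · rw [sgn_insert_of_lt hi h, sgn_insert_of_gt h]; ring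
  · rw [sgn_insert_of_lt hj h, sgn_insert_of_gt h]; ring

theorem sgn_eq_one {i : Fin g} {T : Finset (Fin g)} (h : ∀ j ∈ T, i ≤ j) : sgn A i T = 1 := by
  rw [sgn, Finset.card_eq_zero.mpr, pow_zero]
  exact Finset.filter_eq_empty_iff.mpr fun j hj => (h j hj).not_gt

/-! ### Koszul contractions by commuting endomorphisms -/

section Contract

variable {V : Type*} [AddCommGroup V] [Module A V]

/-- The Koszul differential attached to a family of endomorphisms `θ`: the contraction
`⋀ ⊗ V → ⋀ ⊗ V`, `e_T ⊗ v ↦ ∑ ± e_{T ∖ {i}} ⊗ θ_i v`, where `⋀ ⊗ V` is the module of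
families of elements of `V` indexed by the subsets of `Fin g`. -/
def contract (θ : Fin g → Module.End A V) : (Finset (Fin g) → V) →ₗ[A] (Finset (Fin g) → V) where
  toFun c T := ∑ i ∈ Tᶜ, sgn A i T • θ i (c (insert i T))
  map_add' b c := by
    funext T
    simp only [Pi.add_apply, map_add, smul_add, Finset.sum_add_distrib]
  map_smul' a c := by
    funext T
    simp only [Pi.smul_apply, map_smul, Finset.smul_sum, RingHom.id_apply, smul_comm a]

theorem contract_apply (θ : Fin g → Module.End A V) (c : Finset (Fin g) → V)
    (T : Finset (Fin g)) :
    contract θ c T = ∑ i ∈ Tᶜ, sgn A i T • θ i (c (insert i T)) := rfl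

theorem sum_compl_insert_eq_zero (T : Finset (Fin g)) (f : Fin g → Fin g → V)
    (hf : ∀ i j, i ∉ T → j ∉ T → i ≠ j → f i j = - f j i) :
    ∑ i ∈ Tᶜ, ∑ j ∈ (insert i T)ᶜ, f i j = 0 := by
  rw [Finset.sum_sigma']
  refine Finset.sum_involution (fun p _ => ⟨p.2, p.1⟩) ?_ ?_ ?_ ?_
  · rintro ⟨i, j⟩ h
    simp only [Finset.mem_sigma, Finset.mem_compl, Finset.mem_insert, not_or] at h
    dsimp only
    rw [hf i j h.1 h.2.2 (Ne.symm h.2.1), neg_add_cancel]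
  · rintro ⟨i, j⟩ h - h'
    simp only [Finset.mem_sigma, Finset.mem_compl, Finset.mem_insert, not_or] at h
    exact h.2.1 (congrArg Sigma.fst h')
  · rintro ⟨i, j⟩ h
    simp only [Finset.mem_sigma, Finset.mem_compl, Finset.mem_insert, not_or] at h ⊢
    exact ⟨h.2.2, Ne.symm h.2.1, h.1⟩
  · intros; rfl

theorem contract_contract_apply (θ φ : Fin g → Module.End A V) (c : Finset (Fin g) → V)
    (T : Finset (Fin g)) :
    contract θ (contract φ c) T = ∑ i ∈ Tᶜ, ∑ j ∈ (insert i T)ᶜ,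
      (sgn A i T * sgn A j (insert i T)) • (θ i * φ j) (c (insert j (insert i T))) := by
  simp only [contract_apply, map_sum, map_smul, Finset.smul_sum, smul_smul, Module.End.mul_apply]

theorem contract_contract_self {θ : Fin g → Module.End A V} (h : ∀ i j, Commute (θ i) (θ j))
    (c : Finset (Fin g) → V) : contract θ (contract θ c) = 0 := by
  funext T
  rw [contract_contract_apply]
  refine sum_compl_insert_eq_zero T _ fun i j hi hj hij => ?_
  rw [sgn_mul_sgn_insert hi hj hij, (h i j).eq, Finset.insert_comm, neg_smul]

/-- Used for `dX` and `dY`: because they anticommute, `dX` preserves `ker dY`, so the linear strand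
is a complex. -/
theorem contract_anticomm {θ φ : Fin g → Module.End A V} (h : ∀ i j, Commute (θ i) (φ j))
    (c : Finset (Fin g) → V) : contract θ (contract φ c) = - contract φ (contract θ c) := by
  rw [eq_neg_iff_add_eq_zero]
  funext T
  rw [Pi.add_apply, contract_contract_apply, contract_contract_apply, ← Finset.sum_add_distrib]
  simp only [← Finset.sum_add_distrib]
  refine sum_compl_insert_eq_zero T _ fun i j hi hj hij => ?_
  rw [sgn_mul_sgn_insert hi hj hij, (h i j).eq, ← (h j i).eq, Finset.insert_comm, neg_smul,
    neg_smul, neg_add, add_comm]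

/-- The operator `e_T ⊗ v ↦ e_k ∧ e_T ⊗ ψ v`. -/
def wedge (k : Fin g) (ψ : Module.End A V) (c : Finset (Fin g) → V) : Finset (Fin g) → V :=
  fun T => if k ∈ T then sgn A k (T.erase k) • ψ (c (T.erase k)) else 0

/-- The Leibniz rule `∂(e_k ∧ ψ c) = θ_k ψ c - e_k ∧ ψ ∂c`: when `θ_k` is invertible the Koszul
complex is contractible. -/
theorem contract_wedge {θ : Fin g → Module.End A V} {k : Fin g} {ψ : Module.End A V}
    (h : ∀ i, Commute (θ i) ψ) (hk : θ k * ψ = 1) (c : Finset (Fin g) → V)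
    (hc : contract θ c = 0) : contract θ (wedge k ψ c) = c := by
  funext T
  rw [contract_apply]
  by_cases hkT : k ∈ T
  -- Closedness of `c` at `T ∖ {k}` expresses `c T` through the `c (insert i (T ∖ {k}))` with `i ∉
  -- T`, and these are the terms of the contraction.
  · have h0 := congrFun hc (T.erase k)
    rw [contract_apply] at h0
    have hcompl : (T.erase k)ᶜ = insert k Tᶜ := by
      ext i; simp only [Finset.mem_compl, Finset.mem_erase, Finset.mem_insert]; tauto
    rw [hcompl, Finset.sum_insert (by simpa using hkT), Finset.insert_erase hkT] at h0
    have h1 := congrArg (fun v => sgn A k (T.erase k) • ψ v) h0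
    simp only [map_add, map_smul, smul_add, smul_smul, sgn_mul_self, one_smul, map_sum,
      Finset.smul_sum, Pi.zero_apply, map_zero, smul_zero] at h1
    rw [← Module.End.mul_apply, ← (h k).eq, hk, Module.End.one_apply] at h1
    rw [eq_comm, ← sub_eq_zero, ← h1, sub_eq_add_neg, ← Finset.sum_neg_distrib]
    congr 1
    refine Finset.sum_congr rfl fun i hi => ?_
    have hi' : i ∉ T := by simpa using hi
    have hik : i ≠ k := fun e => hi' (e ▸ hkT)
    rw [wedge, if_pos (Finset.mem_insert_of_mem hkT), Finset.erase_insert_of_ne hik, map_smul,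
      ← Module.End.mul_apply, (h i).eq, Module.End.mul_apply, smul_smul, ← neg_smul]
    congr 1
    have := sgn_mul_sgn_insert (A := A) (i := k) (j := i) (T := T.erase k) (by simp)
      (by simp [hi']) hik.symm
    rw [Finset.insert_erase hkT] at this
    have e1 := sgn_mul_self (A := A) k (T.erase k)
    have e2 := sgn_mul_self (A := A) k (insert i (T.erase k))
    linear_combination (- sgn A k (T.erase k) * sgn A k (insert i (T.erase k))) * this +
      sgn A i T * sgn A k (insert i (T.erase k)) * e1 +
      sgn A k (T.erase k) * sgn A i (T.erase k) * e2
  · rw [Finset.sum_eq_single k]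
    · rw [wedge, if_pos (Finset.mem_insert_self _ _), Finset.erase_insert hkT, map_smul,
        ← Module.End.mul_apply, hk, Module.End.one_apply, smul_smul, sgn_mul_self, one_smul]
    · intro i _ hik
      rw [wedge, if_neg (by simp [hik.symm, hkT]), map_zero, smul_zero]
    · intro h'
      exact absurd (Finset.mem_compl.mpr hkT) h'

end Contract

/-! ### The Koszul complexes of the variables `Y` and of the scalars `X` -/

section Polynomial

variable {B : Type*} [AddCommGroup B] [Module A B]

/-- The module `B[Y₁, …, Y_g]` (or rather its completion), by coefficients. -/
abbrev Coeff (g : ℕ) (B : Type*) : Type _ := (Fin g → ℕ) → B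

/-- Families of polynomials indexed by subsets of `Fin g`, that is, `⋀ ⊗ B[Y₁, …, Y_g]`. -/
abbrev Forms (g : ℕ) (B : Type*) : Type _ := Finset (Fin g) → Coeff g B

/-- Multiplication by `Y_i`. -/
def shift (A : Type*) [CommRing A] {B : Type*} [AddCommGroup B] [Module A B] (i : Fin g) :
    Module.End A (Coeff g B) where
  toFun v α := if α i = 0 then 0 else v (α - Pi.single i 1)
  map_add' v w := by
    funext α
    by_cases h : α i = 0 <;> simp [h]
  map_smul' a v := by
    funext α
    by_cases h : α i = 0 <;> simp [h]

theorem shift_apply (i : Fin g) (v : Coeff g B) (α : Fin g → ℕ) :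
    shift A i v α = if α i = 0 then 0 else v (α - Pi.single i 1) := rfl

theorem shift_comm (i j : Fin g) : Commute (shift A i) (shift A j : Module.End A (Coeff g B)) := by
  rcases eq_or_ne i j with rfl | h
  · exact Commute.refl _
  · refine LinearMap.ext fun v => funext fun α => ?_
    simp only [Module.End.mul_apply, shift_apply, Pi.sub_apply, Pi.single_eq_of_ne h,
      Pi.single_eq_of_ne h.symm, Nat.sub_zero]
    by_cases h1 : α i = 0 <;> by_cases h2 : α j = 0 <;> simp [h1, h2, tsub_right_comm]

/-- Multiplication by scalars `X_i`. -/
def scale (X : Fin g → A) (B : Type*) [AddCommGroup B] [Module A B] (i : Fin g) :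
    Module.End A (Coeff g B) :=
  algebraMap A _ (X i)

theorem scale_apply (X : Fin g → A) (i : Fin g) (v : Coeff g B) : scale X B i v = X i • v := rfl

theorem scale_comm (X : Fin g → A) (i : Fin g) (θ : Module.End A (Coeff g B)) :
    Commute (scale X B i) θ := Algebra.commutes _ _

/-- The Koszul differential with respect to the variables `Y_i`. -/
def dY (A : Type*) [CommRing A] {B : Type*} [AddCommGroup B] [Module A B] :
    Forms g B →ₗ[A] Forms g B := contract (shift A)

/-- The Koszul differential with respect to the scalars `X_i`. -/
def dX (X : Fin g → A) : Forms g B →ₗ[A] Forms g B := contract (scale X B)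

theorem dX_apply (X : Fin g → A) (z : Forms g B) (T : Finset (Fin g)) (α : Fin g → ℕ) :
    dX X z T α = ∑ i ∈ Tᶜ, sgn A i T • X i • z (insert i T) α := by
  simp [dX, contract_apply, scale_apply]

theorem dY_apply (z : Forms g B) (T : Finset (Fin g)) (α : Fin g → ℕ) :
    dY A z T α = ∑ i ∈ Tᶜ, sgn A i T •
      if α i = 0 then 0 else z (insert i T) (α - Pi.single i 1) := by
  simp [dY, contract_apply, shift_apply]

theorem dY_dY (z : Forms g B) : dY A (dY A z) = 0 := contract_contract_self shift_comm z

theorem dX_dX (X : Fin g → A) (z : Forms g B) : dX X (dX X z) = 0 :=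
  contract_contract_self (fun _ _ => scale_comm X _ _) z

theorem dX_dY (X : Fin g → A) (z : Forms g B) : dX X (dY A z) = - dY A (dX X z) :=
  contract_anticomm (fun _ _ => scale_comm X _ _) z

/-- The contracting homotopy of the Koszul complex of the variables: it maps `e_T ⊗ Y^α` to
`e_i ∧ e_T ⊗ Y^α / Y_i` if the least index `i` that occurs in `e_T ⊗ Y^α` is not in `T`, and to
zero otherwise. -/
def homotopy (z : Forms g B) : Forms g B := fun T α =>
  if h : T.Nonempty then
    if ∀ j, α j ≠ 0 → T.min' h ≤ j then z (T.erase (T.min' h)) (α + Pi.single (T.min' h) 1) else 0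
  else 0

theorem homotopy_of_min (z : Forms g B) {T : Finset (Fin g)} {m : Fin g} (hm : m ∈ T)
    (h : ∀ j ∈ T, m ≤ j) (α : Fin g → ℕ) :
    homotopy z T α = if ∀ j, α j ≠ 0 → m ≤ j then z (T.erase m) (α + Pi.single m 1) else 0 := by
  have hT : T.Nonempty := ⟨m, hm⟩
  have : T.min' hT = m := le_antisymm (T.min'_le _ hm) (T.le_min' hT m h)
  rw [homotopy, dif_pos hT, this]

theorem homotopy_eq_zero (z : Forms g B) {T : Finset (Fin g)} {m : Fin g}
    (h : ∀ j ∈ T, m < j) (α : Fin g → ℕ) (hα : α m ≠ 0) : homotopy z T α = 0 := by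
  rw [homotopy]
  split_ifs with hT h'
  · exact absurd (h' m hα) (h _ (T.min'_mem hT)).not_ge
  · rfl
  · rfl

/-- The variables form a regular sequence: the Koszul complex of the variables is exact. -/
theorem dY_homotopy_add (z : Forms g B) (T : Finset (Fin g)) (α : Fin g → ℕ)
    (h : T.Nonempty ∨ α ≠ 0) : dY A (homotopy z) T α + homotopy (dY A z) T α = z T α := by
  obtain ⟨m, hm, hmin⟩ : ∃ m, (m ∈ T ∨ α m ≠ 0) ∧ ∀ j, (j ∈ T ∨ α j ≠ 0) → m ≤ j := by
    have hne : (T ∪ Finset.univ.filter fun j => α j ≠ 0).Nonempty := by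
      rcases h with ⟨i, hi⟩ | h
      · exact ⟨i, by simp [hi]⟩
      · obtain ⟨i, hi⟩ := Function.ne_iff.mp h
        exact ⟨i, by simpa using Or.inr hi⟩
    refine ⟨_, by simpa using Finset.min'_mem _ hne, fun j hj => Finset.min'_le _ _ ?_⟩
    simpa using hj
  rw [dY_apply]
  by_cases hmT : m ∈ T
  -- The term `i = m` of `homotopy (dY z)` is `z T α`; its other terms cancel against `dY (homotopy
  -- z)`, since adding `i > m` leaves the minimum unchanged.
  · rw [homotopy_of_min _ hmT fun j hj => hmin j (Or.inl hj),
      if_pos fun j hj => hmin j (Or.inr hj), dY_apply]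
    have hcompl : (T.erase m)ᶜ = insert m Tᶜ := by
      ext i; simp only [Finset.mem_compl, Finset.mem_erase, Finset.mem_insert]; tauto
    rw [hcompl, Finset.sum_insert (by simpa using hmT), Finset.insert_erase hmT,
      sgn_eq_one fun j hj => hmin j (Or.inl (Finset.mem_of_mem_erase hj)), one_smul,
      if_neg (by simp), add_tsub_cancel_right, add_left_comm, ← Finset.sum_add_distrib,
      Finset.sum_eq_zero, add_zero]
    intro i hi
    have hiT : i ∉ T := by simpa using hi
    have him : i ≠ m := fun e => hiT (e ▸ hmT)
    by_cases hαi : α i = 0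
    · simp [hαi, him]
    · have hlt : m < i := lt_of_le_of_ne (hmin i (Or.inr hαi)) him.symm
      rw [if_neg hαi, if_neg (by simp [hαi]),
        homotopy_of_min (m := m) _ (Finset.mem_insert_of_mem hmT) (by
          intro j hj
          rcases Finset.mem_insert.mp hj with rfl | hj
          · exact hlt.le
          · exact hmin j (Or.inl hj)), if_pos (by
          intro j hj
          refine hmin j (Or.inr fun e => hj ?_)
          simp [e]), Finset.erase_insert_of_ne him]
      have e1 : α - Pi.single i 1 + Pi.single m 1 = α + Pi.single m 1 - Pi.single i 1 := by
        funext j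
        by_cases hj : j = i
        · subst hj; simp [him]
        · simp [hj]
      have e2 : sgn A i T = - sgn A i (T.erase m) := by
        conv_lhs => rw [← Finset.insert_erase hmT]
        rw [sgn_insert_of_lt (by simp) hlt]
      rw [e1, e2, neg_smul, neg_add_cancel]
  -- Here `homotopy (dY z)` vanishes at `(T, α)`, and only the term `i = m` of `dY (homotopy z)`
  -- survives.
  · have hαm : α m ≠ 0 := hm.resolve_left hmT
    have hlt : ∀ j ∈ T, m < j := fun j hj =>
      lt_of_le_of_ne (hmin j (Or.inl hj)) fun e => hmT (e ▸ hj)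
    rw [homotopy_eq_zero _ hlt α hαm, add_zero, Finset.sum_eq_single m]
    · rw [sgn_eq_one fun j hj => (hlt j hj).le, one_smul, if_neg hαm,
        homotopy_of_min (m := m) _ (Finset.mem_insert_self _ _) (by
          intro j hj
          rcases Finset.mem_insert.mp hj with rfl | hj
          · exact le_rfl
          · exact (hlt j hj).le), if_pos (by
          intro j hj
          refine hmin j (Or.inr fun e => hj ?_)
          simp [e]), Finset.erase_insert hmT]
      congr 1
      funext j
      by_cases hj : j = m
      · subst hj; simp; omega
      · simp [hj]
    · intro i hi him
      by_cases hαi : α i = 0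
      · simp [hαi]
      · have hlt' : m < i := lt_of_le_of_ne (hmin i (Or.inr hαi)) him.symm
        rw [if_neg hαi, homotopy_eq_zero (m := m), smul_zero]
        · intro j hj
          rcases Finset.mem_insert.mp hj with rfl | hj
          · exact hlt'
          · exact hlt j hj
        · simpa [him.symm] using hαm
    · intro h'
      exact absurd (Finset.mem_compl.mpr hmT) h'

/-! ### Bihomogeneous forms and the kernel of `dY` -/

/-- Forms in `⋀^q ⊗ B[Y]_n`. -/
def IsHomogeneous (q n : ℕ) (z : Forms g B) : Prop :=
  ∀ T α, z T α ≠ 0 → T.card = q ∧ ∑ i, α i = n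

theorem IsHomogeneous.sub {q n : ℕ} {z w : Forms g B} (hz : IsHomogeneous q n z)
    (hw : IsHomogeneous q n w) : IsHomogeneous q n (z - w) := by
  intro T α h
  by_cases h' : z T α = 0
  · exact hw T α fun e => h (by simp [h', e])
  · exact hz T α h'

theorem IsHomogeneous.neg {q n : ℕ} {z : Forms g B} (hz : IsHomogeneous q n z) :
    IsHomogeneous q n (-z) := fun T α h => hz T α fun e => h (by simp [e])

theorem IsHomogeneous.dX {q n : ℕ} {z : Forms g B} (X : Fin g → A)
    (hz : IsHomogeneous (q + 1) n z) : IsHomogeneous q n (dX X z) := by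
  intro T α h
  rw [dX_apply] at h
  obtain ⟨i, hi, h⟩ := Finset.exists_ne_zero_of_sum_ne_zero h
  have := hz (insert i T) α fun e => h (by simp [e])
  rw [Finset.card_insert_of_notMem (by simpa using hi)] at this
  exact ⟨by omega, this.2⟩

theorem sum_add_single (α : Fin g → ℕ) (i : Fin g) :
    ∑ j, (α + Pi.single i 1 : Fin g → ℕ) j = ∑ j, α j + 1 := by
  simp [Finset.sum_add_distrib]

theorem sub_single_add {α : Fin g → ℕ} {i : Fin g} (h : α i ≠ 0) :
    α - Pi.single i 1 + Pi.single i 1 = α := by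
  funext j
  by_cases hj : j = i
  · subst hj; simp; omega
  · simp [hj]

theorem IsHomogeneous.dY {q n : ℕ} {z : Forms g B} (hz : IsHomogeneous (q + 1) n z) :
    IsHomogeneous q (n + 1) (dY A z) := by
  intro T α h
  rw [dY_apply] at h
  obtain ⟨i, hi, h⟩ := Finset.exists_ne_zero_of_sum_ne_zero h
  have hα : α i ≠ 0 := fun e => h (by simp [e])
  rw [if_neg hα] at h
  have := hz (insert i T) (α - Pi.single i 1) fun e => h (by simp [e])
  rw [Finset.card_insert_of_notMem (by simpa using hi)] at this
  refine ⟨by omega, ?_⟩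
  rw [← sub_single_add hα, sum_add_single, this.2]

theorem IsHomogeneous.homotopy {q n : ℕ} {z : Forms g B} (hz : IsHomogeneous q (n + 1) z) :
    IsHomogeneous (q + 1) n (homotopy z) := by
  intro T α h
  rw [Koszul.homotopy] at h
  split_ifs at h with hT h'
  · have := hz _ _ h
    rw [sum_add_single, Finset.card_erase_of_mem (T.min'_mem hT)] at this
    have := hT.card_pos
    omega
  all_goals exact absurd rfl h

theorem IsHomogeneous.wedge {q n : ℕ} {z : Forms g B} (hz : IsHomogeneous q n z) (k : Fin g)
    (ψ : Module.End A B) : IsHomogeneous (q + 1) n (wedge k (ψ.compLeft _) z) := by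
  intro T α h
  rw [Koszul.wedge] at h
  split_ifs at h with hT
  · have := hz (T.erase k) α fun e => h (by simp [e])
    rw [Finset.card_erase_of_mem hT] at this
    have := Finset.card_pos.mpr ⟨k, hT⟩
    omega
  · exact absurd rfl h

theorem dY_homotopy {q n : ℕ} {z : Forms g B} (hz : IsHomogeneous q (n + 1) z)
    (h : dY A z = 0) : dY A (homotopy z) = z := by
  funext T α
  by_cases hα : T.Nonempty ∨ α ≠ 0
  · have := dY_homotopy_add (A := A) z T α hα
    rwa [h, show homotopy (0 : Forms g B) T α = 0 by simp [homotopy], add_zero] at this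
  -- The constants at `T = ∅`, `α = 0`, where the homotopy identity fails, are excluded by the
  -- positive degree `n + 1`.
  · push Not at hα
    have e1 : z T α = 0 := by
      by_contra e
      have := (hz T α e).2
      simp [hα.2] at this
    rw [e1, dY_apply]
    simp [hα.2]

/-- A closed form is `dY` of a form of exterior degree `q + 1 > g`, which must be zero. This bounds
the length of the linear strand. -/
theorem eq_zero_of_le {q n : ℕ} (hq : g ≤ q) {z : Forms g B} (hz : IsHomogeneous q (n + 1) z)
    (h : dY A z = 0) : z = 0 := by
  have : homotopy z = 0 := by
    funext T α
    by_contra e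
    have := (hz.homotopy T α e).1
    have := Finset.card_le_univ T
    simp at this
    omega
  rw [← dY_homotopy hz h, this, map_zero]

/-! ### Evaluation at `Y = X` and exactness of the linear strand -/

/-- The value `∑ X^α v_α` of a homogeneous polynomial of degree `n`. -/
def eval (X : Fin g → A) (n : ℕ) : Coeff g B →ₗ[A] B :=
  ∑ α ∈ Finset.univ.piAntidiag n, (∏ i, X i ^ α i) • LinearMap.proj α

theorem eval_apply (X : Fin g → A) (n : ℕ) (v : Coeff g B) :
    eval X n v = ∑ α ∈ Finset.univ.piAntidiag n, (∏ i, X i ^ α i) • v α := by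
  simp [eval]

theorem eval_shift (X : Fin g → A) (n : ℕ) (i : Fin g) (v : Coeff g B) :
    eval X (n + 1) (shift A i v) = X i • eval X n v := by
  rw [eval_apply, eval_apply, Finset.smul_sum]
  symm
  refine Finset.sum_bij_ne_zero (fun α _ _ => α + Pi.single i 1) ?_ ?_ ?_ ?_
  · intro α hα _
    have : ∑ j, α j = n := by simpa using hα
    simp only [Finset.mem_piAntidiag, Finset.mem_univ, implies_true, and_true]
    rw [sum_add_single, this]
  · intro α _ _ β _ _ h
    exact add_right_cancel h
  · intro α hα h
    have hαi : α i ≠ 0 := fun e => h (by rw [shift_apply, if_pos e, smul_zero])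
    have hs : ∑ j, α j = n + 1 := by simpa using hα
    have hsa := sub_single_add hαi
    refine ⟨α - Pi.single i 1, ?_, ?_, hsa⟩
    · simp only [Finset.mem_piAntidiag, Finset.mem_univ, implies_true, and_true]
      rw [← hsa, sum_add_single] at hs
      exact Nat.succ_injective hs
    · intro e
      apply h
      rw [shift_apply, if_neg hαi]
      have : ∏ j, X j ^ α j = X i * ∏ j, X j ^ (α - Pi.single i 1 : Fin g → ℕ) j := by
        conv_lhs => rw [← hsa]
        simp only [Pi.add_apply, pow_add, Finset.prod_mul_distrib]
        rw [mul_comm]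
        congr 1
        rw [Finset.prod_eq_single i] <;> simp +contextual
      rw [this, mul_smul, e]
  · intro α _ _
    rw [shift_apply, if_neg (by simp), add_tsub_cancel_right, smul_smul]
    congr 1
    simp only [Pi.add_apply, pow_add, Finset.prod_mul_distrib]
    rw [mul_comm]
    congr 1
    rw [Finset.prod_eq_single i] <;> simp +contextual

/-- After setting `Y = X` the two differentials agree. Thus evaluation vanishes on `dX` of a
`dY`-closed form. -/
theorem eval_dX (X : Fin g → A) (n : ℕ) (z : Forms g B) :
    eval X n (dX X z ∅) = eval X (n + 1) (dY A z ∅) := by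
  simp only [dX, dY, contract_apply, map_sum, map_smul, eval_shift, scale_apply]

theorem sum_sgn_smul_mem (D : AddSubgroup B) (T : Finset (Fin g)) (f : Fin g → B)
    (hf : ∀ i, f i ∈ D) : ∑ i ∈ Tᶜ, sgn A i T • f i ∈ D := by
  refine sum_mem fun i _ => ?_
  rcases neg_one_pow_eq_or A (T.filter (· < i)).card with h | h
  · rw [sgn, h, one_smul]; exact hf i
  · rw [sgn, h, neg_one_smul]; exact neg_mem (hf i)

theorem dX_mem {X : Fin g → A} {D D' : AddSubgroup B} (hD : ∀ i, ∀ b ∈ D, X i • b ∈ D')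
    {z : Forms g B} (hz : ∀ T α, z T α ∈ D) (T : Finset (Fin g)) (α : Fin g → ℕ) :
    dX X z T α ∈ D' := by
  rw [dX_apply]
  exact sum_sgn_smul_mem _ _ _ fun i => hD i _ (hz _ _)

theorem dY_mem {D : AddSubgroup B} {z : Forms g B} (hz : ∀ T α, z T α ∈ D)
    (T : Finset (Fin g)) (α : Fin g → ℕ) : dY A z T α ∈ D := by
  rw [dY_apply]
  refine sum_sgn_smul_mem _ _ _ fun i => ?_
  split_ifs
  exacts [zero_mem _, hz _ _]

theorem homotopy_mem {D : AddSubgroup B} {z : Forms g B} (hz : ∀ T α, z T α ∈ D)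
    (T : Finset (Fin g)) (α : Fin g → ℕ) : homotopy z T α ∈ D := by
  rw [homotopy]
  split_ifs
  exacts [hz _ _, zero_mem _, zero_mem _]

theorem wedge_mem {D D' : AddSubgroup B} {ψ : Module.End A B} (hψ : ∀ b ∈ D, ψ b ∈ D') (k : Fin g)
    {z : Forms g B} (hz : ∀ T α, z T α ∈ D) (T : Finset (Fin g)) (α : Fin g → ℕ) :
    wedge k (ψ.compLeft _) z T α ∈ D' := by
  rw [wedge]
  split_ifs
  · rcases neg_one_pow_eq_or A ((T.erase k).filter (· < k)).card with h | h
    · rw [sgn, h, one_smul]; exact hψ _ (hz _ _)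
    · rw [sgn, h, neg_one_smul]; exact neg_mem (hψ _ (hz _ _))
  · exact zero_mem _

/-- If some `X_k` is invertible on `B`, then the linear strand of the diagonal is exact. -/
theorem exists_dX_eq {X : Fin g → A} {k : Fin g} {ψ : Module.End A B}
    (hψ : algebraMap A (Module.End A B) (X k) * ψ = 1) {D : ℤ → AddSubgroup B}
    (hD : ∀ i j, ∀ b ∈ D j, X i • b ∈ D (j + 1)) (hψD : ∀ j, ∀ b ∈ D (j + 1), ψ b ∈ D j)
    {q n : ℕ} {j : ℤ} {z : Forms g B} (hz : IsHomogeneous q n z)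
    (hzD : ∀ T α, z T α ∈ D (j + 1)) (hY : dY A z = 0) (hX : dX X z = 0)
    (hev : eval X n (z ∅) = 0) :
    ∃ w : Forms g B, IsHomogeneous (q + 1) n w ∧ (∀ T α, w T α ∈ D j) ∧ dY A w = 0 ∧
      dX X w = z := by
  induction n generalizing q j z with
  -- In degree zero the strand contributes nothing: `dY`-closed constants vanish in positive
  -- exterior degree, and on exterior degree zero evaluation is the identity.
  | zero =>
    suffices z = 0 from ⟨0, fun _ _ h => absurd rfl h, fun _ _ => zero_mem _, map_zero _,
      by rw [map_zero, this]⟩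
    funext T α
    by_contra e
    obtain ⟨-, hα⟩ := hz T α e
    obtain rfl : α = 0 := funext fun i => by
      simpa using Finset.sum_eq_zero_iff.mp hα i (Finset.mem_univ i)
    rcases T.eq_empty_or_nonempty with rfl | hT
    · apply e
      simpa [eval_apply] using hev
    · have := dY_homotopy_add (A := A) z T 0 (Or.inl hT)
      rw [hY, dY_apply, show homotopy (0 : Forms g B) T 0 = 0 by simp [homotopy]] at this
      simp only [Pi.zero_apply, if_true, smul_zero, Finset.sum_const_zero, add_zero] at this
      exact e this.symm
  | succ n ih =>
    -- Lift `z` through `dY` to `homotopy z`, of polynomial degree `n`. Its `dX` again satisfies all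
    -- hypotheses, with coefficients one degree higher, so induction supplies a `dY`-closed `w` with
    -- the same `dX`.
    have hu := dY_homotopy hz hY
    have huh := hz.homotopy
    have huD := homotopy_mem (D := D (j + 1)) hzD
    obtain ⟨w, hw, hwD, hwY, hwX⟩ := ih (j := j + 1) (huh.dX X) (dX_mem (fun i => hD i _) huD)
      (by rw [← neg_eq_zero, ← dX_dY, hu, hX]) (dX_dX X _)
      (by rw [eval_dX, hu, hev])
    set u := homotopy z - w with hu'
    have huX : dX X u = 0 := by rw [hu', map_sub, hwX, sub_self]
    -- Now `dX u = 0` and `dY u = z`. Invertibility of `X_k` gives `u = dX v`, and then `dX (-dY v)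
    -- = dY (dX v) = z`.
    have hv : dX X (wedge k (ψ.compLeft _) u) = u :=
      contract_wedge (fun _ => scale_comm X _ _) (LinearMap.ext fun v => funext fun α =>
        LinearMap.congr_fun hψ (v α)) u huX
    refine ⟨-dY A (wedge k (ψ.compLeft _) u), ((huh.sub hw).wedge k ψ).dY.neg, fun T α => ?_, ?_,
      ?_⟩
    · exact neg_mem (dY_mem (wedge_mem (hψD j) k fun T α => sub_mem (huD T α) (hwD T α)) T α)
    · rw [map_neg, dY_dY, neg_zero]
    · rw [map_neg, dX_dY, neg_neg, hv, hu', map_sub, hu, hwY, sub_zero]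

/-- The coefficientwise extension of a linear map to forms. -/
def mapForms {B' : Type*} [AddCommGroup B'] [Module A B'] (f : B →ₗ[A] B') :
    Forms g B →ₗ[A] Forms g B' := (f.compLeft _).compLeft _

section Map

variable {B' : Type*} [AddCommGroup B'] [Module A B'] (f : B →ₗ[A] B')

theorem mapForms_apply (z : Forms g B) (T : Finset (Fin g)) (α : Fin g → ℕ) :
    mapForms f z T α = f (z T α) := rfl

theorem mapForms_dX (X : Fin g → A) (z : Forms g B) :
    mapForms f (dX X z) = dX X (mapForms f z) := by
  funext T α
  simp only [mapForms_apply, dX_apply, map_sum, map_smul]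

theorem mapForms_dY (z : Forms g B) : mapForms f (dY A z) = dY A (mapForms f z) := by
  funext T α
  simp only [mapForms_apply, dY_apply, map_sum, map_smul, apply_ite f, map_zero]

theorem mapForms_eval (X : Fin g → A) (n : ℕ) (v : Coeff g B) :
    f (eval X n v) = eval X n fun α => f (v α) := by
  simp only [eval_apply, map_sum, map_smul]

theorem IsHomogeneous.mapForms {q n : ℕ} {z : Forms g B} (hz : IsHomogeneous q n z) :
    IsHomogeneous q n (mapForms f z) := by
  intro T α h
  exact hz T α fun e => h (by rw [mapForms_apply, e, map_zero])

end Map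

end Polynomial

end Koszul

/-! ### The Čech complex and the linear strand of the diagonal -/

namespace Cech

open Koszul

variable {A : Type*} [CommRing A] {g : ℕ}

/-! ### Degrees in the localizations, and lifting of closed forms -/

section Degree

variable (x : Fin g → A) {M : Type*} [AddCommGroup M] [Module A M] (ℳ : ℤ → AddSubgroup M)
  (e : Fin g → ℤ)

theorem smul_prod_mem (hx : ∀ k j, ∀ m ∈ ℳ j, x k • m ∈ ℳ (j + e k)) (U : Finset (Fin g)) (j : ℤ)
    (m : M) (hm : m ∈ ℳ j) : (∏ k ∈ U, x k) • m ∈ ℳ (j + ∑ k ∈ U, e k) := by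
  induction U using Finset.induction_on generalizing j m with
  | empty => simpa using hm
  | insert k U hk ih =>
    rw [Finset.prod_insert hk, Finset.sum_insert hk, mul_smul, add_comm (e k), ← add_assoc]
    exact hx _ _ _ (ih _ _ hm)

theorem toLoc_mem_locDegree (S : Finset (Fin g)) {j : ℤ} {m : M} (hm : m ∈ ℳ j) :
    toLoc x M S m ∈ locDegree x ℳ e j S :=
  AddSubgroup.subset_closure ⟨0, m, by simpa using hm, by simp⟩

theorem smul_mem_locDegree (hx : ∀ k j, ∀ m ∈ ℳ j, x k • m ∈ ℳ (j + e k)) (S : Finset (Fin g))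
    (k : Fin g) (j : ℤ) (y : Loc x M S) (hy : y ∈ locDegree x ℳ e j S) :
    x k • y ∈ locDegree x ℳ e (j + e k) S := by
  have : locDegree x ℳ e j S ≤
      (locDegree x ℳ e (j + e k) S).comap (DistribSMul.toAddMonoidHom _ (x k)) := by
    refine (AddSubgroup.closure_le _).mpr ?_
    rintro y ⟨p, m, hm, hy⟩
    refine AddSubgroup.subset_closure ⟨p, x k • m, ?_, ?_⟩
    · rw [add_right_comm]; exact hx _ _ _ hm
    · simp only [DistribSMul.toAddMonoidHom_apply]
      rw [smul_comm, hy, map_smul]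
  exact this hy

theorem exists_inverse (S : Finset (Fin g)) (k : Fin g) (hk : k ∈ S) :
    ∃ ψ : Module.End A (Loc x M S), algebraMap A (Module.End A (Loc x M S)) (x k) * ψ = 1 := by
  have h := isUnit_of_subset x M (Finset.singleton_subset_iff.mpr hk)
    ⟨∏ i ∈ {k}, x i, Submonoid.mem_powers _⟩
  rw [Finset.prod_singleton] at h
  exact h.exists_right_inv

/-- With `k ∈ S`, division by `x_k` is multiplication by `∏_{i ∈ S ∖ {k}} x_i` followed by one more
division by `x_S`. -/
theorem inverse_mem_locDegree (hx : ∀ k j, ∀ m ∈ ℳ j, x k • m ∈ ℳ (j + e k))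
    {S : Finset (Fin g)} {k : Fin g} (hk : k ∈ S) {ψ : Module.End A (Loc x M S)}
    (hψ : algebraMap A (Module.End A (Loc x M S)) (x k) * ψ = 1) (j : ℤ) (y : Loc x M S)
    (hy : y ∈ locDegree x ℳ e (j + e k) S) : ψ y ∈ locDegree x ℳ e j S := by
  have : locDegree x ℳ e (j + e k) S ≤ (locDegree x ℳ e j S).comap ψ.toAddMonoidHom := by
    refine (AddSubgroup.closure_le _).mpr ?_
    rintro y ⟨p, m, hm, hy⟩
    refine AddSubgroup.subset_closure ⟨p + 1, (∏ i ∈ S.erase k, x i) • m, ?_, ?_⟩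
    · have := smul_prod_mem x ℳ e hx (S.erase k) _ m hm
      convert this using 2
      rw [← Finset.add_sum_erase S e hk]
      push_cast; ring
    · have h1 : x k • ψ y = y := LinearMap.congr_fun hψ y
      have h2 : (∏ i ∈ S, x i) ^ (p + 1) = (∏ i ∈ S.erase k, x i) * (∏ i ∈ S, x i) ^ p * x k := by
        rw [← Finset.mul_prod_erase S x hk]; ring
      change _ • ψ y = _
      rw [h2, mul_smul, h1, mul_smul, hy, map_smul]
  exact this hy

theorem locDegree_empty_le (j : ℤ) :
    locDegree x ℳ e j ∅ ≤ (ℳ j).map (toLoc x M ∅).toAddMonoidHom := by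
  refine (AddSubgroup.closure_le _).mpr ?_
  rintro y ⟨p, m, hm, hy⟩
  rw [Finset.prod_empty, one_pow, one_smul] at hy
  rw [Finset.sum_empty, mul_zero, add_zero] at hm
  exact ⟨m, hm, hy.symm⟩

theorem res_toLoc {S S' : Finset (Fin g)} (h : S ⊆ S') (m : M) :
    res x M h (toLoc x M S m) = toLoc x M S' m := by
  simp [res, IsLocalizedModule.lift_apply]

/-- The cochain with all components equal to a given element. -/
noncomputable def diag (i : ℕ) (m : M) : Cochain x M i := fun S => toLoc x M S.1 m

theorem d_diag (m : M) : d x M 0 (diag x 0 m) = diag x (0 + 1) m := by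
  funext ⟨S, hS⟩
  rw [zero_add] at hS
  obtain ⟨k, rfl⟩ := Finset.card_eq_one.mp hS
  simp only [d, LinearMap.coe_mk, AddHom.coe_mk, diag, res_toLoc]
  rw [Fintype.sum_eq_single ⟨k, Finset.mem_singleton_self k⟩]
  · simp [Finset.filter_singleton]
  · rintro ⟨l, hl⟩ h
    exact absurd (Subtype.ext (Finset.mem_singleton.mp hl)) h

theorem exists_d_eq {i : ℕ} {j : ℤ} (h : Subsingleton (gradedCohomology x ℳ e (i + 1) j))
    {c : Cochain x M (i + 1)} (hc : c ∈ cochainDegree x ℳ e (i + 1) j)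
    (hd : d x M (i + 1) c = 0) : ∃ b ∈ cochainDegree x ℳ e i j, d x M i b = c := by
  have h2 := (QuotientAddGroup.eq_zero_iff (N := (coboundaries x ℳ e (i + 1) j).addSubgroupOf
    (cocycles x ℳ e (i + 1) j)) ⟨c, hc, hd⟩).mp (Subsingleton.elim _ _)
  exact h2

/-- Vanishing of cohomology for forms that are closed under the Koszul differential of the
variables. -/
theorem exists_mapForms_d_eq {f i q n : ℕ} {j : ℤ}
    (h : Subsingleton (gradedCohomology x ℳ e (i + 1) j))
    {z : Forms f (Cochain x M (i + 1))} (hz : IsHomogeneous q (n + 1) z)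
    (hzD : ∀ T α, z T α ∈ cochainDegree x ℳ e (i + 1) j) (hY : dY A z = 0)
    (hd : mapForms (d x M (i + 1)) z = 0) :
    ∃ b : Forms f (Cochain x M i), IsHomogeneous q (n + 1) b ∧
      (∀ T α, b T α ∈ cochainDegree x ℳ e i j) ∧ dY A b = 0 ∧ mapForms (d x M i) b = z := by
  -- Lifting the coefficients of `z` themselves could destroy `dY`-closedness. So `homotopy z` is
  -- lifted instead, and `dY` applied afterwards; zero coefficients get the lift zero to keep
  -- homogeneity.
  have key : ∀ T α, ∃ b ∈ cochainDegree x ℳ e i j, d x M i b = homotopy z T α ∧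
      (homotopy z T α = 0 → b = 0) := by
    intro T α
    by_cases h0 : homotopy z T α = 0
    · exact ⟨0, zero_mem _, by rw [map_zero, h0], fun _ => rfl⟩
    · have hcoc : homotopy z T α ∈ cocycles x ℳ e (i + 1) j :=
        homotopy_mem (D := cocycles x ℳ e (i + 1) j)
          (fun T α => ⟨hzD T α, congrFun (congrFun hd T) α⟩) T α
      obtain ⟨b, hb, hdb⟩ := exists_d_eq x ℳ e h hcoc.1 hcoc.2
      exact ⟨b, hb, hdb, fun h => absurd h h0⟩
  choose b hb hdb hb0 using key
  have hbh : IsHomogeneous (q + 1) n b := fun T α h =>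
    hz.homotopy T α fun h' => h (hb0 T α h')
  refine ⟨dY A b, hbh.dY, dY_mem hb, dY_dY b, ?_⟩
  rw [mapForms_dY, show mapForms (d x M i) b = homotopy z from funext fun T => funext (hdb T),
    dY_homotopy hz hY]

end Degree

section Component

variable (x : Fin g → A) {M : Type*} [AddCommGroup M] [Module A M]

/-- The projection of the Čech cochains to the component of `S`. -/
noncomputable def component {i : ℕ} (S : {S : Finset (Fin g) // S.card = i}) :
    Cochain x M i →ₗ[A] Loc x M S.1 := LinearMap.proj S

theorem component_apply {i : ℕ} (S : {S : Finset (Fin g) // S.card = i}) (c : Cochain x M i) :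
    component x S c = c S := rfl

end Component

/-! ### The double complex and the descent -/

section Strand

variable (x : Fin (g + 1) → A) {M : Type*} [AddCommGroup M] [Module A M] (ℳ : ℤ → AddSubgroup M)
  (e : Fin (g + 1) → ℤ)

/-- A set with at least two indices contains some `k.succ`, so `x_{k.succ}` is invertible on that
component; exactness of the strand is applied component by component. -/
theorem exists_dX_eq (hx : ∀ k j, ∀ m ∈ ℳ j, x k • m ∈ ℳ (j + e k)) (he : ∀ k : Fin g, e k.succ = 1)
    {p q n : ℕ} {j : ℤ} {z : Forms g (Cochain x M (p + 2))} (hz : IsHomogeneous q n z)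
    (hzD : ∀ T α, z T α ∈ cochainDegree x ℳ e (p + 2) (j + 1)) (hY : dY A z = 0)
    (hX : dX (fun k => x (Fin.succ k)) z = 0) (hev : eval (fun k => x (Fin.succ k)) n (z ∅) = 0) :
    ∃ w : Forms g (Cochain x M (p + 2)), IsHomogeneous (q + 1) n w ∧
      (∀ T α, w T α ∈ cochainDegree x ℳ e (p + 2) j) ∧ dY A w = 0 ∧
      dX (fun k => x (Fin.succ k)) w = z := by
  have key : ∀ S : {S : Finset (Fin (g + 1)) // S.card = p + 2}, ∃ w : Forms g (Loc x M S.1),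
      IsHomogeneous (q + 1) n w ∧ (∀ T α, w T α ∈ locDegree x ℳ e j S.1) ∧ dY A w = 0 ∧
      dX (fun k => x (Fin.succ k)) w = mapForms (component x S) z := by
    intro S
    obtain ⟨k, hk⟩ : ∃ k : Fin g, k.succ ∈ S.1 := by
      obtain ⟨l, hl, hl0⟩ := Finset.exists_mem_ne (by rw [S.2]; omega : 1 < S.1.card) 0
      obtain ⟨k, rfl⟩ := Fin.exists_succ_eq.mpr hl0
      exact ⟨k, hl⟩
    obtain ⟨ψ, hψ⟩ := exists_inverse x (M := M) S.1 k.succ hk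
    refine Koszul.exists_dX_eq (k := k) hψ (D := fun j => locDegree x ℳ e j S.1) ?_ ?_
      (hz.mapForms _) (fun T α => hzD T α S) ?_ ?_ ?_
    · intro i j b hb
      rw [← he i]
      exact smul_mem_locDegree x ℳ e hx _ _ _ _ hb
    · intro j b hb
      refine inverse_mem_locDegree x ℳ e hx hk hψ j b ?_
      rwa [he k]
    · rw [← mapForms_dY, hY, map_zero]
    · rw [← mapForms_dX, hX, map_zero]
    · have := mapForms_eval (component x S) (fun k : Fin g => x k.succ) n (z ∅)
      rw [hev, map_zero] at this
      exact this.symm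
  choose w hw hwD hwY hwX using key
  refine ⟨fun T α S => w S T α, ?_, fun T α S => hwD S T α, ?_, ?_⟩
  · intro T α h
    obtain ⟨S, hS⟩ := Function.ne_iff.mp h
    exact hw S T α hS
  · funext T α S
    have := congrFun (congrFun (mapForms_dY (component x S) fun T α S => w S T α) T) α
    exact this.trans (congrFun (congrFun (hwY S) T) α)
  · funext T α S
    have := congrFun (congrFun (mapForms_dX (component x S) (fun k => x (Fin.succ k))
      fun T α S => w S T α) T) α
    exact this.trans (congrFun (congrFun (hwX S) T) α)

/-- The descent along the double complex formed by the Čech complex and the linear strand. -/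
theorem exists_eq_d_add_dX (hx : ∀ k j, ∀ m ∈ ℳ j, x k • m ∈ ℳ (j + e k))
    (he : ∀ k : Fin g, e k.succ = 1) {r : ℤ}
    (hvanish : ∀ (i : ℕ) (j : ℤ), 1 ≤ i → i ≤ g → i + j = r + 1 →
      Subsingleton (gradedCohomology x ℳ e i j))
    {n : ℕ} (k q : ℕ) (hq : g ≤ q + k) {z : Forms g (Cochain x M (q + 1))}
    (hz : IsHomogeneous q (n + 1) z)
    (hzD : ∀ T α, z T α ∈ cochainDegree x ℳ e (q + 1) (r - q)) (hY : dY A z = 0)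
    (hX : dX (fun k => x (Fin.succ k)) (mapForms (d x M (q + 1)) z) = 0)
    (hev : eval (fun k => x (Fin.succ k)) (n + 1) (mapForms (d x M (q + 1)) z ∅) = 0) :
    ∃ (b : Forms g (Cochain x M q)) (w : Forms g (Cochain x M (q + 1))),
      (∀ T α, b T α ∈ cochainDegree x ℳ e q (r - q)) ∧ IsHomogeneous q (n + 1) b ∧
      dY A b = 0 ∧ dY A w = 0 ∧
      z = mapForms (d x M q) b + dX (fun k => x (Fin.succ k)) w := by
  by_cases hgq : g ≤ q
  · refine ⟨0, 0, fun _ _ => zero_mem _, fun _ _ h => absurd rfl h, map_zero _, map_zero _, ?_⟩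
    rw [eq_zero_of_le hgq hz hY, map_zero, map_zero, add_zero]
  induction k generalizing q with
  | zero => exact absurd hq hgq
  | succ k ih =>
    -- Each step along the strand raises Čech degree and lowers coefficient degree by one, staying
    -- on the diagonal.
    have h1 : r - (q + 1 : ℕ) + 1 = r - q := by push_cast; ring
    obtain ⟨z', hz', hzD', hY', hX'⟩ := exists_dX_eq x ℳ e hx he (j := r - (q + 1 : ℕ))
      (hz.mapForms (d x M (q + 1))) (fun T α => by
        have := d_mem_cochainDegree x ℳ e hx _ _ _ (hzD T α)
        rw [h1]
        exact this) (by rw [← mapForms_dY, hY, map_zero]) hX hev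
    have hdz' : dX (fun k => x (Fin.succ k)) (mapForms (d x M (q + 1 + 1)) z') = 0 := by
      rw [← mapForms_dX, hX']
      funext T α
      exact d_d x M _ _
    -- In positive exterior degree there is no component at `∅`, so the condition on the evaluation
    -- is vacuous from here on.
    have h0 : mapForms (d x M (q + 1 + 1)) z' ∅ = 0 := by
      funext α
      by_contra h
      simpa using (hz'.mapForms (d x M (q + 1 + 1)) ∅ α h).1
    obtain ⟨b', w', hbD', hb', hbY', hwY', hzw'⟩ : ∃ (b : Forms g (Cochain x M (q + 1)))
        (w : Forms g (Cochain x M (q + 1 + 1))),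
        (∀ T α, b T α ∈ cochainDegree x ℳ e (q + 1) (r - (q + 1 : ℕ))) ∧
        IsHomogeneous (q + 1) (n + 1) b ∧ dY A b = 0 ∧ dY A w = 0 ∧
        z' = mapForms (d x M (q + 1)) b + dX (fun k => x (Fin.succ k)) w := by
      by_cases hgq' : g ≤ q + 1
      · refine ⟨0, 0, fun _ _ => zero_mem _, fun _ _ h => absurd rfl h, map_zero _, map_zero _, ?_⟩
        rw [eq_zero_of_le hgq' hz' hY', map_zero, map_zero, add_zero]
      · exact ih (q + 1) (by omega) hz' hzD' hY' hdz' (by rw [h0, map_zero]) hgq'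
    -- The corrected form `z - dX b'` is a Čech cocycle: `d z = dX z'`, and `z' = d b' + dX w'` with
    -- `dX (dX w') = 0`.
    obtain ⟨b, hb, hbD, hbY, hdb⟩ := exists_mapForms_d_eq x ℳ e
      (hvanish (q + 1) (r - q) (by omega) (by omega) (by push_cast; ring))
      (hz.sub (hb'.dX fun k => x (Fin.succ k)))
      (fun T α => sub_mem (hzD T α) (dX_mem (D := cochainDegree x ℳ e (q + 1) (r - (q + 1 : ℕ)))
        (fun i c hc S => by
          have := smul_mem_locDegree x ℳ e hx S.1 i.succ _ _ (hc S)
          rw [he] at this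
          rw [h1] at this
          exact this) hbD' T α))
      (by rw [map_sub, hY, ← neg_neg (dY A _), ← dX_dY, hbY', map_zero, neg_zero, sub_zero])
      (by
        rw [map_sub, mapForms_dX, ← hX', hzw', map_add, dX_dX, add_zero, sub_self])
    exact ⟨b, b', hbD, hb, hbY, hbY', by rw [hdb, sub_add_cancel]⟩

theorem exists_pow_smul_eq (hx : ∀ k j, ∀ m ∈ ℳ j, x k • m ∈ ℳ (j + e k)) {S : Finset (Fin (g + 1))}
    {k : Fin (g + 1)} (hk : k ∈ S) (n : ℕ) (j : ℤ) (y : Loc x M S)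
    (hy : y ∈ locDegree x ℳ e (j + n * e k) S) :
    ∃ y' ∈ locDegree x ℳ e j S, x k ^ n • y' = y := by
  obtain ⟨ψ, hψ⟩ := exists_inverse x (M := M) S k hk
  induction n generalizing j with
  | zero => exact ⟨y, by simpa using hy, by simp⟩
  | succ n ih =>
    obtain ⟨y', hy', h⟩ := ih (j + e k) (by convert hy using 2; push_cast; ring)
    refine ⟨ψ y', inverse_mem_locDegree x ℳ e hx hk hψ j y' hy', ?_⟩
    rw [pow_succ, mul_smul, show x k • ψ y' = y' from LinearMap.congr_fun hψ y', h]

/-- The coefficients are `v_α / x₀^s`. -/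
theorem exists_eval_eq_of_zero_mem (hx : ∀ k j, ∀ m ∈ ℳ j, x k • m ∈ ℳ (j + e k)) {r : ℤ}
    {n s : ℕ} {m : M} {v : Coeff g M} (hv : ∀ α, v α ∈ ℳ (r + s * e 0))
    (hvm : eval (fun k => x (Fin.succ k)) n v = x 0 ^ s • m) {S : Finset (Fin (g + 1))}
    (hS : 0 ∈ S) :
    ∃ y : Coeff g (Loc x M S), (∀ α, y α ≠ 0 → ∑ i, α i = n) ∧
      (∀ α, y α ∈ locDegree x ℳ e r S) ∧
      eval (fun k => x (Fin.succ k)) n y = toLoc x M S m := by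
  choose y hy hyv using fun α => exists_pow_smul_eq x ℳ e hx hS s r _
    (toLoc_mem_locDegree x ℳ e S (hv α))
  refine ⟨fun α => if ∑ i, α i = n then y α else 0, fun α h => ?_, fun α => ?_, ?_⟩
  · by_contra h'
    exact h (if_neg h')
  · dsimp only
    split_ifs
    exacts [hy α, zero_mem _]
  · obtain ⟨ψ, hψ⟩ := exists_inverse x (M := M) S 0 hS
    have hinj : Function.Injective fun y : Loc x M S => x 0 ^ s • y := by
      have hc : ψ * algebraMap A (Module.End A (Loc x M S)) (x 0) = 1 := by
        rw [← Algebra.commutes, hψ]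
      have := Function.LeftInverse.injective (g := ψ) (LinearMap.congr_fun hc)
      have h2 : (fun y : Loc x M S => x 0 ^ s • y) = (fun y : Loc x M S => x 0 • y)^[s] := by
        rw [smul_iterate]
      rw [h2]
      exact this.iterate s
    apply hinj
    dsimp only
    rw [← map_smul (toLoc x M S), ← hvm, mapForms_eval, ← map_smul, eval_apply, eval_apply]
    refine Finset.sum_congr rfl fun α hα => ?_
    rw [Pi.smul_apply, if_pos (by simpa using hα), hyv]

/-- The single monomial `(m / x_k^n) Y_k^n` does it. -/
theorem exists_eval_eq_of_succ_mem (hx : ∀ k j, ∀ m ∈ ℳ j, x k • m ∈ ℳ (j + e k))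
    (he : ∀ k : Fin g, e k.succ = 1) {r : ℤ} {n : ℕ} {m : M} (hm : m ∈ ℳ (r + n))
    {S : Finset (Fin (g + 1))} {k : Fin g} (hS : k.succ ∈ S) :
    ∃ y : Coeff g (Loc x M S), (∀ α, y α ≠ 0 → ∑ i, α i = n) ∧
      (∀ α, y α ∈ locDegree x ℳ e r S) ∧
      eval (fun k => x (Fin.succ k)) n y = toLoc x M S m := by
  obtain ⟨y, hy, hym⟩ := exists_pow_smul_eq x ℳ e hx hS n r _
    (by rw [he, mul_one]; exact toLoc_mem_locDegree x ℳ e S hm)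
  refine ⟨Pi.single (Pi.single k n) y, fun α h => ?_, fun α => ?_, ?_⟩
  · obtain rfl : α = Pi.single k n := by
      by_contra h'
      exact h (Pi.single_eq_of_ne h' _)
    simp
  · rw [Pi.single_apply]
    split_ifs
    exacts [hy, zero_mem _]
  · rw [eval_apply, Finset.sum_eq_single (Pi.single k n), Pi.single_eq_same, ← hym]
    · congr 1
      rw [Finset.prod_eq_single k] <;> simp +contextual
    · intro α _ h
      rw [Pi.single_eq_of_ne h, smul_zero]
    · intro h
      exact absurd (by simp) h

/-- If a diagonal of graded local cohomology vanishes, then an element that lies locally at `x₀`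
in `(x₁, …, x_g)ⁿ M_r` does so globally. -/
theorem exists_eval_eq (hx : ∀ k j, ∀ m ∈ ℳ j, x k • m ∈ ℳ (j + e k))
    (he : ∀ k : Fin g, e k.succ = 1) {r : ℤ}
    (hvanish : ∀ (i : ℕ) (j : ℤ), 1 ≤ i → i ≤ g → i + j = r + 1 →
      Subsingleton (gradedCohomology x ℳ e i j))
    {n s : ℕ} {m : M} (hm : m ∈ ℳ (r + (n + 1 : ℕ))) {v : Coeff g M}
    (hv : ∀ α, v α ∈ ℳ (r + s * e 0))
    (hvm : eval (fun k => x (Fin.succ k)) (n + 1) v = x 0 ^ s • m) :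
    ∃ u : Coeff g M, (∀ α, u α ∈ ℳ r) ∧
      toLoc x M {0} (eval (fun k => x (Fin.succ k)) (n + 1) u) = toLoc x M {0} m := by
  have key : ∀ S : {S : Finset (Fin (g + 1)) // S.card = 0 + 1}, ∃ y : Coeff g (Loc x M S.1),
      (∀ α, y α ≠ 0 → ∑ i, α i = n + 1) ∧ (∀ α, y α ∈ locDegree x ℳ e r S.1) ∧
      eval (fun k => x (Fin.succ k)) (n + 1) y = toLoc x M S.1 m := by
    intro S
    obtain ⟨l, hl⟩ := Finset.card_eq_one.mp (S.2.trans (zero_add 1))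
    have hlS : l ∈ S.1 := hl ▸ Finset.mem_singleton_self l
    clear hl
    induction l using Fin.cases with
    | zero => exact exists_eval_eq_of_zero_mem x ℳ e hx hv hvm hlS
    | succ k => exact exists_eval_eq_of_succ_mem x ℳ e hx he hm hlS
  choose y hys hyD hym using key
  -- The local solutions on the sets `{l}` form one element of `L₀` with coefficients in the Čech
  -- 1-cochains.
  set z : Forms g (Cochain x M (0 + 1)) := fun T α S => if T = ∅ then y S α else 0 with hzdef
  have hz : IsHomogeneous 0 (n + 1) z := by
    intro T α h
    obtain ⟨S, hS⟩ := Function.ne_iff.mp h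
    by_cases hT : T = ∅
    · subst hT
      exact ⟨rfl, hys S α (by simpa [hzdef] using hS)⟩
    · exact absurd (by simp [hzdef, hT]) hS
  have hzD : ∀ T α, z T α ∈ cochainDegree x ℳ e (0 + 1) (r - (0 : ℕ)) := by
    intro T α S
    simp only [hzdef, Nat.cast_zero, sub_zero]
    split_ifs
    exacts [hyD S α, zero_mem _]
  have hevz : eval (fun k => x (Fin.succ k)) (n + 1) (z ∅) = diag x (0 + 1) m := by
    funext S
    change _ = toLoc x M S.1 m
    rw [← hym S]
    exact (mapForms_eval (component x S) (fun k : Fin g => x k.succ) (n + 1) (z ∅)).trans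
      (by simp [hzdef, component_apply])
  have hcard : ∀ {p : ℕ} {c : Forms g (Cochain x M p)}, IsHomogeneous 0 (n + 1) c →
      contract (shift A) c = 0 ∧ contract (scale (fun k => x (Fin.succ k)) _) c = 0 := by
    intro p c hc
    have h0 : ∀ (T : Finset (Fin g)) i, i ∈ Tᶜ → c (insert i T) = 0 := by
      intro T i _
      funext α
      by_contra h
      simpa using (hc _ α h).1
    constructor <;>
    · funext T
      rw [contract_apply]
      exact Finset.sum_eq_zero fun i hi => by rw [h0 T i hi, map_zero, smul_zero]
  -- The value of `z` is the coboundary of `m`, so `d z` evaluates to zero and the descent can start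
  -- at `q = 0`.
  obtain ⟨b, w, hbD, -, -, hwY, hzw⟩ := exists_eq_d_add_dX x ℳ e hx he hvanish g 0 (by omega) hz
    hzD (hcard hz).1 (hcard (hz.mapForms _)).2 (by
      have h1 := mapForms_eval (d x M (0 + 1)) (fun k : Fin g => x k.succ) (n + 1) (z ∅)
      rw [hevz, ← d_diag, d_d] at h1
      exact h1.symm)
  have hu : ∀ α, ∃ u ∈ ℳ r, ∀ S, toLoc x M S.1 u = b ∅ α S := by
    intro α
    obtain ⟨u, hu, h⟩ := locDegree_empty_le x ℳ e _ (hbD ∅ α ⟨∅, rfl⟩)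
    refine ⟨u, by simpa using hu, fun ⟨S, hS⟩ => ?_⟩
    obtain rfl := Finset.card_eq_zero.mp hS
    exact h
  choose u hu hub using hu
  refine ⟨u, hu, ?_⟩
  have h1 : eval (fun k => x (Fin.succ k)) (n + 1) (b ∅) =
      diag x 0 (eval (fun k => x (Fin.succ k)) (n + 1) u) := by
    funext S
    change _ = toLoc x M S.1 (eval (fun k => x (Fin.succ k)) (n + 1) u)
    rw [mapForms_eval]
    exact (mapForms_eval (component x S) (fun k : Fin g => x k.succ) (n + 1) (b ∅)).trans
      (by simp [hub, component_apply])
  have h2 : eval (fun k => x (Fin.succ k)) (n + 1) (z ∅) =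
      d x M 0 (eval (fun k => x (Fin.succ k)) (n + 1) (b ∅)) := by
    rw [mapForms_eval, hzw, Pi.add_apply, map_add, eval_dX, hwY]
    simp only [Pi.zero_apply, map_zero, add_zero]
    rfl
  rw [hevz, h1, d_diag] at h2
  exact (congrFun h2 ⟨{0}, by simp⟩).symm

end Strand

end Cech

/-! ### Intersections of powers of an ideal with a filtration -/

namespace IdealFiltration

open Koszul LaurentPolynomial

variable {R : Type*} [CommRing R] {g : ℕ} (a : Fin g → R)

theorem exists_eval_eq_of_mem_pow (n : ℕ) {c : R} (hc : c ∈ Ideal.span (Set.range a) ^ n) :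
    ∃ v : Coeff g R, eval a n v = c := by
  suffices h : Ideal.span (Set.range a) ^ n ≤ LinearMap.range (eval a n : Coeff g R →ₗ[R] R) from
    h hc
  clear hc
  induction n with
  | zero =>
    intro c _
    exact ⟨fun _ => c, by simp [eval_apply]⟩
  | succ n ih =>
    rw [pow_succ]
    refine Ideal.mul_le.mpr fun c hc b hb => ?_
    obtain ⟨v, rfl⟩ := ih hc
    obtain ⟨b, rfl⟩ := Ideal.mem_span_range_iff_exists_fun.mp hb
    refine ⟨∑ k, shift R k (b k • v), ?_⟩
    simp only [map_sum, eval_shift, map_smul, smul_eq_mul, Finset.mul_sum]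
    exact Finset.sum_congr rfl fun k _ => by ring

theorem eval_mem_pow_mul (n : ℕ) (K : Ideal R) {v : Coeff g R} (hv : ∀ α, v α ∈ K) :
    eval a n v ∈ Ideal.span (Set.range a) ^ n * K := by
  rw [eval_apply]
  refine sum_mem fun α hα => Ideal.mul_mem_mul ?_ (hv α)
  have hα : ∑ i, α i = n := by simpa using hα
  rw [← hα, ← Finset.prod_pow_eq_pow_sum]
  exact Ideal.prod_mem_prod fun i _ =>
    Ideal.pow_mem_pow (Ideal.subset_span (Set.mem_range_self i)) _

/-! ### Homogeneous elements of the extended Rees algebra and the conclusion -/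

variable {a} {F : IdealFiltration R} (h : F.IsAdmissible (Ideal.span (Set.range a)))

/-- The homogeneous element `c tʲ` of the extended Rees algebra of a filtration. -/
noncomputable def monomial (j : ℤ) (c : R) (hc : c ∈ F.ideal j.toNat) : extReesModule h :=
  ⟨C c * T j, fun n => by
    rw [← single_eq_C_mul_T, AddMonoidAlgebra.coeff_single, Finsupp.single_apply]
    split_ifs with hn
    · exact hn ▸ hc
    · exact zero_mem _⟩

theorem monomial_mem (j : ℤ) (c : R) (hc : c ∈ F.ideal j.toNat) :
    monomial h j c hc ∈ extReesDegree h j := by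
  intro n hn
  change (C c * T j).coeff n = 0
  rw [← single_eq_C_mul_T, AddMonoidAlgebra.coeff_single, Finsupp.single_apply, if_neg hn.symm]

theorem exists_monomial_eq {j : ℤ} {f : extReesModule h} (hf : f ∈ extReesDegree h j) :
    ∃ c hc, f = monomial h j c hc := by
  refine ⟨(f : R[T;T⁻¹]).coeff j, f.2 j, Subtype.ext ?_⟩
  change (f : R[T;T⁻¹]) = C _ * T j
  rw [← single_eq_C_mul_T]
  ext n
  rw [AddMonoidAlgebra.coeff_single, Finsupp.single_apply]
  split_ifs with hn
  · rw [hn]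
  · exact hf n (Ne.symm hn)

theorem coe_eval_generatorsJ (n : ℕ) (j : ℤ) {v : Coeff g R} (hv : ∀ α, v α ∈ F.ideal j.toNat) :
    ((eval (fun k => generatorsJ a (Fin.succ k)) n fun α => monomial h j (v α) (hv α) :
      extReesModule h) : R[T;T⁻¹]) = C (eval a n v) * T (n + j) := by
  rw [eval_apply, eval_apply, AddSubmonoidClass.coe_finsetSum, map_sum, Finset.sum_mul]
  refine Finset.sum_congr rfl fun α hα => ?_
  have hα : ∑ i, α i = n := by simpa using hα
  change ((∏ i, generatorsJ a (Fin.succ i) ^ α i : (adic _).extRees) : R[T;T⁻¹]) *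
    (C (v α) * T j) = _
  have h1 : ((∏ i, generatorsJ a (Fin.succ i) ^ α i :
      (adic (Ideal.span (Set.range a))).extRees) : R[T;T⁻¹]) = C (∏ i, a i ^ α i) * T n := by
    rw [SubmonoidClass.coe_finsetProd, map_prod, ← hα, Nat.cast_sum]
    have h2 : (T (∑ i, (α i : ℤ)) : R[T;T⁻¹]) = ∏ i, T 1 ^ α i := by
      simp only [T_pow, mul_one]
      induction (Finset.univ : Finset (Fin g)) using Finset.induction_on with
      | empty => simp
      | insert i s hi ih => rw [Finset.sum_insert hi, Finset.prod_insert hi, T_add, ih]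
    rw [h2, ← Finset.prod_mul_distrib]
    refine Finset.prod_congr rfl fun i _ => ?_
    change (C (a i) * T 1) ^ α i = _
    rw [mul_pow, map_pow]
  rw [h1, smul_eq_mul, map_mul, T_add]
  ring

/-- The vanishing of the diagonal `i + j = r + 1` of `Hⁱ_J(R'(F))_j` for `1 ≤ i ≤ g` suffices for
the inclusion, since `(t⁻¹, at)` acts on `R'(F) ⊆ R[t, t⁻¹]` with `t⁻¹` a nonzerodivisor: neither
the regularity of the generators nor the depth of `G(F)` is needed for this direction. -/
theorem pow_inf_le_of_subsingleton {r : ℕ}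
    (hvanish : ∀ (i : ℕ) (j : ℤ), 1 ≤ i → i ≤ g → (i : ℤ) + j = r + 1 →
      Subsingleton (localCohomologyExtRees a h i j)) (n : ℕ) :
    Ideal.span (Set.range a) ^ (n + 1) ⊓ F.ideal (n + 1 + r) ≤
      Ideal.span (Set.range a) ^ (n + 1) * F.ideal r := by
  rintro c ⟨hcI, hcF⟩
  obtain ⟨v, rfl⟩ := exists_eval_eq_of_mem_pow a (n + 1) hcI
  set m := monomial h (r + (n + 1 : ℕ)) (eval a (n + 1) v)
    (by rwa [← Nat.cast_add, Int.toNat_natCast, add_comm]) with hm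
  -- With `s = r`, multiplication by `t^{-r}` takes `m` to degree `n + 1`, so the coefficients `v_α`
  -- have degree `0`, where `I₀ = R` imposes no condition.
  obtain ⟨u, hu, hum⟩ := Cech.exists_eval_eq (generatorsJ a) (extReesDegree h) (degreesJ g)
    (generatorsJ_smul_mem a h) (fun _ => rfl) hvanish (n := n) (s := r) (m := m)
    (monomial_mem h _ _ _)
    (v := fun α => monomial h 0 (v α) (by simp [F.zero_eq])) (fun α => by
      have := monomial_mem h 0 (v α) (by simp [F.zero_eq])
      simpa [degreesJ] using this)
    (by
      apply Subtype.ext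
      rw [coe_eval_generatorsJ]
      change _ = (T (-1) : R[T;T⁻¹]) ^ r * (C (eval a (n + 1) v) * T (r + (n + 1 : ℕ)))
      rw [T_pow, mul_left_comm, ← T_add]
      congr 2
      push_cast; ring)
  choose w hw huw using fun α => exists_monomial_eq h (hu α)
  obtain rfl : u = fun α => monomial h r (w α) (hw α) := funext huw
  -- Equality in the localization holds in `M` up to a power of `t⁻¹`, which is cancelled in `R[t,
  -- t⁻¹]`.
  obtain ⟨⟨_, p, rfl⟩, hp⟩ := (IsLocalizedModule.eq_iff_exists
    (Submonoid.powers (∏ k ∈ {0}, generatorsJ a k)) (Cech.toLoc (generatorsJ a) _ {0})).mp hum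
  have h1 : (T (-1) : R[T;T⁻¹]) ^ p * (C (eval a (n + 1) w) * T ((n + 1 : ℕ) + r)) =
      (T (-1) : R[T;T⁻¹]) ^ p * (C (eval a (n + 1) v) * T (r + (n + 1 : ℕ))) := by
    rw [← coe_eval_generatorsJ h (n + 1) r hw]
    have h2 := congrArg (Subtype.val : extReesModule h → R[T;T⁻¹]) hp
    simp only [Finset.prod_singleton] at h2
    exact h2
  have hunit : IsUnit ((T (-1) : R[T;T⁻¹]) ^ p) := (isUnit_T _).pow p
  have h3 := hunit.mul_left_cancel h1
  rw [add_comm (r : ℤ)] at h3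
  have h4 : eval a (n + 1) w = eval a (n + 1) v := by
    simpa [C_apply] using congrArg (fun f : R[T;T⁻¹] => f.coeff 0)
      ((isUnit_T _).mul_right_cancel h3)
  rw [← h4]
  exact eval_mem_pow_mul a (n + 1) _ (by simpa using hw)

end IdealFiltration

theorem mainTheorem7 {R : Type*} [CommRing R] [IsLocalRing R] (hR : IsCohenMacaulayLocal R)
    {g : ℕ} (hg : 1 ≤ g) (a : Fin g → R)
    (ha : RingTheory.Sequence.IsRegular R (List.ofFn a))
    (F : IdealFiltration R) (hF : F.IsAdmissible (Ideal.span (Set.range a)))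
    (r : ℕ) (hr : 1 ≤ r)
    (hvanish : ∀ (i : ℕ) (j : ℤ), 1 ≤ i → i ≤ g → (i : ℤ) + j = r + 1 →
      Subsingleton (IdealFiltration.localCohomologyExtRees a hF i j))
    (hdepth : ((g - 1 : ℕ) : ℕ∞) ≤ F.gradedDepth) (n : ℕ) :
    Ideal.span (Set.range a) ^ n ⊓ F.ideal (n + r) = Ideal.span (Set.range a) ^ n * F.ideal r := by
  refine le_antisymm ?_ (le_inf Ideal.mul_le_left
    ((Ideal.mul_mono_left (hF.pow_le n)).trans (F.mul_le n r)))
  cases n with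
  | zero => simp
  | succ n => exact IdealFiltration.pow_inf_le_of_subsingleton hF hvanish n
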